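/- **Setting.** Consider $L$ cells, each with one $N$-antenna base station and $K$ single-antenna users, $1\le K\le N$; fix a cell $l$ and a user $k$ of it. Let $\beta_{lij}>0$ be the large-scale fading between base station $l$ and user $j$ of cell $i$, $p_r>0$ the transmit power, $\tau\ge K$ the pilot length (training power $p_{\rm tr}=\tau p_r$), and $\alpha\in[-1,1]$, $\alpha\neq0$, the temporal correlation coefficient. Put $$\hat\beta_{lij}=\frac{\beta_{lij}^2}{\sum_{m=1}^L\beta_{lmj}+1/p_{\rm tr}},\qquad C=\sum_{i\neq l}\Big(\frac{\beta_{lik}}{\beta_{llk}}\Big)^2 .$$ Let $\hat G_{ll}$ (the channel estimate at time $n-1$) and $\tilde E_{l1},\dots,\tilde E_{lL}$ (the combined estimation and aging errors at time $n$) be random $N\times K$ complex matrices all of whose columns are mutually independent, the $j$th column of $\hat G_{ll}$ having law $\mathcal{CN}(0,\hat\beta_{llj}I_N)$ and the $j$th column of $\tilde E_{li}$ having law $\mathcal{CN}(0,(\beta_{lij}-\alpha^2\hat\beta_{lij})I_N)$. Let $\hat G_{li}=\hat G_{ll}\,\mathrm{diag}(\beta_{li1}/\beta_{ll1},\dots,\beta_{liK}/\beta_{llK})$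 for $i\ne l$, let $g$ be the $k$th row of the pseudo-inverse $\hat G_{ll}^\dagger=(\hat G_{ll}^{H}\hat G_{ll})^{-1}\hat G_{ll}^{H}$, and let the zero-forcing SINR of user $k$ be $$\gamma_k=\frac{\alpha^2p_r}{\alpha^2p_r\sum_{i\ne l}\|g\,\hat G_{li}\|^2+p_r\sum_{i=1}^L\|g\,\tilde E_{li}\|^2+\|g\|^2}.$$ Let $\mathcal A=\mathrm{diag}(\beta_{lij}-\alpha^2\hat\beta_{lij})_{1\le i\le L,\,1\le j\le K}$, a $KL\times KL$ matrix with distinct diagonal elements $\mu_1>\dots>\mu_\varrho$ of multiplicities $\tau_1,\dots,\tau_\varrho$, and let its characteristic coefficients $\mathcal X_{p,q}$ be defined by the partial fraction expansion $$\det(I+\xi\mathcal A)^{-1}=\sum_{p=1}^{\varrho}\sum_{q=1}^{\tau_p}\frac{\mathcal X_{p,q}}{(1+\xi\mu_p)^q}.$$ **Theorem.** Let $\gamma_{\rm th}\ge0$. If $\gamma_{\rm th}\ge 1/C$ (that is, $C\gamma_{\rm th}\ge1$; $1/C=\infty$ if $L=1$), the outage probability is $P(\gamma_k\le\gamma_{\rm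 th})=1$. If $\gamma_{\rm th}<1/C$, then with $\bar\gamma=\hat\beta_{llk}(\alpha^2-\alpha^2C\gamma_{\rm th})$, $$P(\gamma_k\le\gamma_{\rm th})=1-e^{-\frac{\gamma_{\rm th}}{p_r\bar\gamma}}\sum_{p=1}^{\varrho}\sum_{q=1}^{\tau_p}\sum_{t=0}^{N-K}\sum_{s=0}^{t}\binom ts\,\mathcal X_{p,q}\,\frac{\mu_p^{-q}}{(q-1)!}\,\frac{(\gamma_{\rm th}/\bar\gamma)^t}{t!}\,\Big(\frac1{p_r}\Big)^{t-s}\,\Gamma(s+q)\,\Big(\frac1{\mu_p}+\frac{\gamma_{\rm th}}{\bar\gamma}\Big)^{-(s+q)} .$$ -/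

import Mathlib

open MeasureTheory ProbabilityTheory
open scoped NNReal ENNReal Matrix

noncomputable section

namespace Uplink

/-! ### Circularly symmetric complex Gaussian vectors -/

/-- The law `CN(0, v)` on `ℂ`: independent real and imaginary parts, each `N(0, v / 2)`. -/
def complexGaussian (v : ℝ≥0) : Measure ℂ :=
  ((gaussianReal 0 (v / 2)).prod (gaussianReal 0 (v / 2))).map
    Complex.measurableEquivRealProd.symm

/-- The law `CN(0, v I_N)` on `ℂ^N`: independent coordinates, each `CN(0, v)`. -/
def complexGaussianVec (N : ℕ) (v : ℝ≥0) : Measure (Fin N → ℂ) :=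
  Measure.pi fun _ => complexGaussian v

/-! ### Deterministic parameters of the cellular network

`β l i k` is the large-scale fading between the base station of cell `l` and user `k` of cell `i`,
`pr` the transmit power, `τ` the pilot length, `α` the temporal correlation. -/

section Parameters

variable {L K : ℕ}

/-- Variance of the MMSE channel estimate, `β̂_lik`, with training power `p_tr = τ p_r`. -/
def betaHat (β : Fin L → Fin L → Fin K → ℝ) (pr : ℝ) (τ : ℕ) (l i : Fin L) (k : Fin K) : ℝ :=
  β l i k ^ 2 / (∑ j, β l j k + 1 / ((τ : ℝ) * pr))

/-- Variance `β_lik - α² β̂_lik` of the combined estimation and aging error `ẽ_lik[n]`. -/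
def errVar (β : Fin L → Fin L → Fin K → ℝ) (pr : ℝ) (τ : ℕ) (α : ℝ) (l i : Fin L) (k : Fin K) :
    ℝ :=
  β l i k - α ^ 2 * betaHat β pr τ l i k

/-- The diagonal of the `KL × KL` matrix `𝒜 = diag(D̃_l1, …, D̃_lL)`, where `D̃_li` is the diagonal
matrix of the error variances of the users of cell `i`. -/
def diagA (β : Fin L → Fin L → Fin K → ℝ) (pr : ℝ) (τ : ℕ) (α : ℝ) (l : Fin L) :
    Fin L × Fin K → ℝ :=
  fun ij => errVar β pr τ α l ij.1 ij.2

/-- The pilot contamination constant `C = ∑_{i ≠ l} (β_lik / β_llk)²`. -/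
def contamination (β : Fin L → Fin L → Fin K → ℝ) (l : Fin L) (k : Fin K) : ℝ :=
  ∑ i ∈ Finset.univ.erase l, (β l i k / β l l k) ^ 2

/-- The constant `γ̄ = β̂_llk (α² - α² C γ)`. -/
def gammaBar (β : Fin L → Fin L → Fin K → ℝ) (pr : ℝ) (τ : ℕ) (α : ℝ) (l : Fin L) (k : Fin K)
    (γ : ℝ) : ℝ :=
  betaHat β pr τ l l k * (α ^ 2 - α ^ 2 * contamination β l k * γ)

end Parameters

/-! ### Characteristic coefficients of a diagonal matrix -/

section CharacteristicCoefficients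

variable {ι : Type*} [Fintype ι]

/-- The distinct diagonal elements of `diag(d)`. -/
def distinctDiag (d : ι → ℝ) : Finset ℝ :=
  Finset.univ.image d

/-- The multiplicity of the value `μ` on the diagonal of `diag(d)`. -/
def diagMult (d : ι → ℝ) (μ : ℝ) : ℕ :=
  (Finset.univ.filter fun i => d i = μ).card

/-- The characteristic coefficient of `A = diag(d)` attached to its diagonal element `μ` and the
order `q`: the coefficient of `(1 + ξ μ)^(-q)` in the partial fraction expansion of
`det(I + ξ A)⁻¹`, see `charCoeff_spec`. With `u = 1 + ξ μ` one has `1 + ξ ν = (1 - ν/μ) + (ν/μ) u`,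
so it is the coefficient of `u ^ (τ - q)`, with `τ` the multiplicity of `μ`, in the power series of
the product of `(1 + ξ ν)^(-τ_ν)` over the diagonal elements `ν ≠ μ`. -/
def charCoeff (d : ι → ℝ) (μ : ℝ) (q : ℕ) : ℝ :=
  PowerSeries.coeff (diagMult d μ - q)
    (∏ ν ∈ (distinctDiag d).erase μ,
      (PowerSeries.C (1 - ν / μ) + PowerSeries.C (ν / μ) * PowerSeries.X)⁻¹ ^ diagMult d ν)

open Polynomial in
theorem charCoeff_aux (d : ι → ℝ) {μ : ℝ} (hμ : μ ≠ 0) :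
    (1 + C μ * X) ^ diagMult d μ ∣
      (1 - (∏ ν ∈ (distinctDiag d).erase μ, (1 + C ν * X) ^ diagMult d ν) *
        ∑ q ∈ Finset.Icc 1 (diagMult d μ),
          C (charCoeff d μ q) * (1 + C μ * X) ^ (diagMult d μ - q) : ℝ[X]) := by
  set n := diagMult d μ with hn
  set S := (distinctDiag d).erase μ with hS
  let Q : ℝ[X] := ∏ ν ∈ S, (C (1 - ν / μ) + C (ν / μ) * X) ^ diagMult d ν
  let F : PowerSeries ℝ := ∏ ν ∈ S,
      (PowerSeries.C (1 - ν / μ) + PowerSeries.C (ν / μ) * PowerSeries.X)⁻¹ ^ diagMult d ν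
  have hQF : (Q : PowerSeries ℝ) * F = 1 := by
    have hQ : (Q : PowerSeries ℝ) = ∏ ν ∈ S,
        (PowerSeries.C (1 - ν / μ) + PowerSeries.C (ν / μ) * PowerSeries.X) ^ diagMult d ν := by
      rw [← Polynomial.coeToPowerSeries.ringHom_apply]
      simp only [Q, map_prod, map_pow, map_add, map_mul]
      simp
    rw [hQ, ← Finset.prod_mul_distrib]
    refine Finset.prod_eq_one fun ν hν => ?_
    rw [← mul_pow, PowerSeries.mul_inv_cancel, one_pow]
    have : ν ≠ μ := (Finset.mem_erase.1 hν).1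
    simp only [map_add, map_mul, PowerSeries.constantCoeff_C, PowerSeries.constantCoeff_X, mul_zero,
      add_zero, ne_eq, sub_eq_zero]
    intro h
    rw [eq_div_iff hμ] at h
    exact this (by linarith)
  let T : ℝ[X] := ∑ q ∈ Finset.Icc 1 n, C (charCoeff d μ q) * X ^ (n - q)
  have hT : ∀ m < n, T.coeff m = PowerSeries.coeff m F := by
    intro m hm
    simp only [T, finsetSum_coeff, coeff_C_mul, coeff_X_pow]
    rw [Finset.sum_eq_single (n - m)]
    · rw [if_pos (by omega), mul_one]
      change PowerSeries.coeff (n - (n - m)) F = _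
      congr 2; omega
    · intro q hq hne
      rw [Finset.mem_Icc] at hq
      rw [if_neg (by omega), mul_zero]
    · intro h
      exact absurd (Finset.mem_Icc.2 ⟨by omega, by omega⟩) h
  have hdvd : (X : ℝ[X]) ^ n ∣ 1 - Q * T := by
    rw [X_pow_dvd_iff]
    intro m hm
    have h1 : PowerSeries.coeff m ((Q : PowerSeries ℝ) * F) = (Q * T).coeff m := by
      rw [PowerSeries.coeff_mul, Polynomial.coeff_mul]
      refine Finset.sum_congr rfl fun x hx => ?_
      have := Finset.HasAntidiagonal.mem_antidiagonal.1 hx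
      rw [hT x.2 (by omega), Polynomial.coeff_coe]
    rw [coeff_sub, ← h1, hQF, PowerSeries.coeff_one, coeff_one]
    simp
  obtain ⟨R, hR⟩ := hdvd
  refine ⟨R.comp (1 + C μ * X), ?_⟩
  have h2 := congrArg (fun p : ℝ[X] => p.comp (1 + C μ * X)) hR
  simp only [sub_comp, mul_comp, one_comp, pow_comp, X_comp] at h2
  rw [← h2]
  congr 2
  · simp only [Q, prod_comp, pow_comp, add_comp, mul_comp, C_comp, X_comp]
    refine Finset.prod_congr rfl fun ν _ => ?_
    congr 1
    have : C (1 - ν / μ) + C (ν / μ) * (1 + C μ * X) = (1 + C (ν / μ * μ) * X : ℝ[X]) := by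
      simp only [C_sub, C_mul, C_1]; ring
    rw [this, div_mul_cancel₀ _ hμ]
  · simp only [T, Polynomial.sum_comp, mul_comp, C_comp, pow_comp, X_comp]

open Polynomial in
/-- The coefficients `charCoeff` are those of the partial fraction expansion of
`det(I + ξ A)⁻¹`, for `A = diag(d)`. -/
theorem charCoeff_spec [DecidableEq ι] [Nonempty ι] (d : ι → ℝ) (hd : ∀ i, d i ≠ 0) (ξ : ℝ)
    (hξ : ∀ i, 1 + ξ * d i ≠ 0) :
    (Matrix.det (1 + ξ • Matrix.diagonal d))⁻¹ =
      ∑ μ ∈ distinctDiag d, ∑ q ∈ Finset.Icc 1 (diagMult d μ),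
        charCoeff d μ q / (1 + ξ * μ) ^ q := by
  classical
  have hmem : ∀ μ ∈ distinctDiag d, ∃ i, d i = μ := by
    intro μ h; simpa [distinctDiag] using h
  have hne0 : ∀ μ ∈ distinctDiag d, μ ≠ 0 := by
    intro μ h; obtain ⟨i, rfl⟩ := hmem μ h; exact hd i
  have hξ' : ∀ μ ∈ distinctDiag d, 1 + ξ * μ ≠ 0 := by
    intro μ h; obtain ⟨i, rfl⟩ := hmem μ h; exact hξ i
  have hdet : Matrix.det (1 + ξ • Matrix.diagonal d) =
      ∏ μ ∈ distinctDiag d, (1 + ξ * μ) ^ diagMult d μ := by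
    have : (1 + ξ • Matrix.diagonal d) = Matrix.diagonal fun i => 1 + ξ * d i := by
      rw [← Matrix.diagonal_one, ← Matrix.diagonal_smul, Matrix.diagonal_add]; rfl
    rw [this, Matrix.det_diagonal, distinctDiag,
      Finset.prod_comp (fun μ => 1 + ξ * μ) d]
    rfl
  have hdeg1 : ∀ ν : ℝ, (1 + C ν * X : ℝ[X]).natDegree ≤ 1 := by
    intro ν; compute_degree
  have hdegn : ∀ (ν : ℝ) (m : ℕ), ((1 + C ν * X : ℝ[X]) ^ m).natDegree ≤ m := fun ν m => by
    simpa using natDegree_pow_le_of_le m (hdeg1 ν)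
  let P : ℝ → ℝ[X] := fun ν => (1 + C ν * X) ^ diagMult d ν
  let G : ℝ → ℝ[X] := fun μ => ∑ q ∈ Finset.Icc 1 (diagMult d μ),
          C (charCoeff d μ q) * (1 + C μ * X) ^ (diagMult d μ - q)
  let R : ℝ[X] := 1 - ∑ μ ∈ distinctDiag d, (∏ ν ∈ (distinctDiag d).erase μ, P ν) * G μ
  have hPne : ∀ ν, P ν ≠ 0 := fun ν => pow_ne_zero _ fun h => by
    have := congrArg (fun p : ℝ[X] => p.eval 0) h
    simp at this
  have hPdeg : ∀ ν ∈ distinctDiag d, (P ν).natDegree = diagMult d ν := by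
    intro ν hν
    simp only [P, natDegree_pow]
    rw [add_comm, ← C_1, natDegree_linear (hne0 ν hν), mul_one]
  have hdvd : ∏ ν ∈ distinctDiag d, P ν ∣ R := by
    refine Finset.prod_dvd_of_coprime ?_ ?_
    · intro a ha b hb hab
      refine IsCoprime.pow ?_
      refine ⟨C (b / (b - a)), C (-(a / (b - a))), ?_⟩
      have hba : b - a ≠ 0 := sub_ne_zero.2 (Ne.symm hab)
      have e1 : (C (b / (b - a)) * (1 + C a * X) + C (-(a / (b - a))) * (1 + C b * X) : ℝ[X])
          = C (b / (b - a) + -(a / (b - a)))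
            + C (b / (b - a) * a + -(a / (b - a)) * b) * X := by
        simp only [C_add, C_mul]; ring
      rw [e1, show b / (b - a) + -(a / (b - a)) = 1 by field_simp; ring,
        show b / (b - a) * a + -(a / (b - a)) * b = 0 by ring]
      simp
    · intro μ hμ
      have h1 := charCoeff_aux d (hne0 μ hμ)
      have h2 : R = (1 - (∏ ν ∈ (distinctDiag d).erase μ, P ν) * G μ) -
          ∑ μ' ∈ (distinctDiag d).erase μ, (∏ ν ∈ (distinctDiag d).erase μ', P ν) * G μ' := by
        simp only [R]
        rw [← Finset.add_sum_erase _ _ hμ]; ring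
      rw [h2]
      refine dvd_sub h1 (Finset.dvd_sum fun μ' hμ' => Dvd.dvd.mul_right ?_ _)
      exact Finset.dvd_prod_of_mem P
        (Finset.mem_erase.2 ⟨(Finset.ne_of_mem_erase hμ').symm, hμ⟩)
  have hmult : ∀ μ ∈ distinctDiag d, 1 ≤ diagMult d μ := by
    intro μ h
    obtain ⟨i, hi⟩ := hmem μ h
    exact Finset.card_pos.2 ⟨i, by simp [hi]⟩
  have hSne : (distinctDiag d).Nonempty := Finset.univ_nonempty.image d
  have hdegprod : (∏ ν ∈ distinctDiag d, P ν).natDegree = ∑ ν ∈ distinctDiag d, diagMult d ν := by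
    rw [natDegree_prod _ _ fun ν _ => hPne ν]
    exact Finset.sum_congr rfl hPdeg
  have hpos : 1 ≤ ∑ ν ∈ distinctDiag d, diagMult d ν := by
    obtain ⟨μ, hμ⟩ := hSne
    exact (hmult μ hμ).trans (Finset.single_le_sum (fun _ _ => Nat.zero_le _) hμ)
  have hRdeg : R.natDegree < ∑ ν ∈ distinctDiag d, diagMult d ν := by
    suffices h : R.natDegree ≤ (∑ ν ∈ distinctDiag d, diagMult d ν) - 1 by omega
    refine (natDegree_sub_le _ _).trans (max_le (by simp) ?_)
    refine natDegree_sum_le_of_forall_le _ _ fun μ hμ => ?_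
    have hm := hmult μ hμ
    have hsum := Finset.add_sum_erase _ (diagMult d) hμ
    have e1 : (∏ ν ∈ (distinctDiag d).erase μ, P ν).natDegree
        ≤ ∑ ν ∈ (distinctDiag d).erase μ, diagMult d ν :=
      (natDegree_prod_le _ _).trans (Finset.sum_le_sum fun ν _ => hdegn ν _)
    have e2 : (G μ).natDegree ≤ diagMult d μ - 1 := by
      refine natDegree_sum_le_of_forall_le _ _ fun q hq => ?_
      rw [Finset.mem_Icc] at hq
      refine (natDegree_C_mul_le _ _).trans ((hdegn _ _).trans (by omega))
    refine natDegree_mul_le.trans ?_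
    omega
  have hR0 : R = 0 := by
    by_contra h
    have := natDegree_le_of_dvd hdvd h
    omega
  have heval := congrArg (fun p : ℝ[X] => p.eval ξ) hR0
  simp only [R, P, G, eval_sub, eval_one, eval_finsetSum, eval_mul, eval_prod, eval_pow, eval_add,
    eval_C, eval_X, eval_zero, sub_eq_zero] at heval
  rw [hdet, inv_eq_one_div]
  have hprod : ∏ μ ∈ distinctDiag d, (1 + ξ * μ) ^ diagMult d μ ≠ 0 :=
    Finset.prod_ne_zero_iff.2 fun μ hμ => pow_ne_zero _ (hξ' μ hμ)
  rw [eq_comm, eq_div_iff hprod, Finset.sum_mul]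
  refine Eq.trans ?_ heval.symm
  refine Finset.sum_congr rfl fun μ hμ => ?_
  have hsum : (1 + ξ * μ) ^ diagMult d μ *
      ∑ q ∈ Finset.Icc 1 (diagMult d μ), charCoeff d μ q / (1 + ξ * μ) ^ q =
      ∑ q ∈ Finset.Icc 1 (diagMult d μ), charCoeff d μ q * (1 + μ * ξ) ^ (diagMult d μ - q) := by
    rw [Finset.mul_sum]
    refine Finset.sum_congr rfl fun q hq => ?_
    rw [Finset.mem_Icc] at hq
    rw [mul_comm μ ξ, mul_div_assoc', div_eq_iff (pow_ne_zero _ (hξ' μ hμ)), mul_assoc, ← pow_add,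
      Nat.sub_add_cancel hq.2, mul_comm]
  rw [← hsum, ← Finset.mul_prod_erase _ _ hμ]
  simp only [mul_comm _ ξ]
  ring

end CharacteristicCoefficients

/-! ### The zero-forcing receiver and its SINR -/

section Receiver

variable {N K L : ℕ}

/-- The matrix with the given columns. -/
def ofCols (c : Fin K → Fin N → ℂ) : Matrix (Fin N) (Fin K) ℂ :=
  Matrix.of fun a j => c j a

/-- Pseudo-inverse `(Gᴴ G)⁻¹ Gᴴ` of a matrix of full column rank. -/
def pinv (G : Matrix (Fin N) (Fin K) ℂ) : Matrix (Fin K) (Fin N) ℂ :=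
  (Gᴴ * G)⁻¹ * Gᴴ

/-- The squared Euclidean norm of a complex vector. -/
def sqNorm {m : ℕ} (v : Fin m → ℂ) : ℝ :=
  ∑ j, ‖v j‖ ^ 2

/-- The estimated channel from cell `i` to base station `l` under pilot contamination,
`Ĝ_li = Ĝ_ll D_i` with `D_i = diag(β_li1 / β_ll1, …, β_liK / β_llK)`. -/
def crossEstimate (β : Fin L → Fin L → Fin K → ℝ) (l i : Fin L)
    (Gll : Matrix (Fin N) (Fin K) ℂ) : Matrix (Fin N) (Fin K) ℂ :=
  Gll * Matrix.diagonal fun j => ((β l i j / β l l j : ℝ) : ℂ)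

/-- The post-processing SINR of user `k` in cell `l` under zero forcing, as a function of the
estimated channel matrix `Gll = Ĝ_ll[n-1]` and the error matrices `E i = Ẽ_li[n]`. -/
def sinr (β : Fin L → Fin L → Fin K → ℝ) (pr α : ℝ) (l : Fin L) (k : Fin K)
    (Gll : Matrix (Fin N) (Fin K) ℂ) (E : Fin L → Matrix (Fin N) (Fin K) ℂ) : ℝ :=
  α ^ 2 * pr /
    (α ^ 2 * pr * ∑ i ∈ Finset.univ.erase l, sqNorm (pinv Gll k ᵥ* crossEstimate β l i Gll)
      + pr * ∑ i, sqNorm (pinv Gll k ᵥ* E i)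
      + sqNorm (pinv Gll k))

/-- The outage probability `P(γ_k ≤ γ_th)`, where column `j` of `Ĝ_ll[n-1]` is `ghat j` and column
`j` of `Ẽ_li[n]` is `etilde (i, j)`. -/
def outageProb {Ω : Type*} [MeasurableSpace Ω] (P : Measure Ω)
    (β : Fin L → Fin L → Fin K → ℝ) (pr α : ℝ) (l : Fin L) (k : Fin K)
    (ghat : Fin K → Ω → Fin N → ℂ) (etilde : Fin L × Fin K → Ω → Fin N → ℂ) (γth : ℝ) : ℝ :=
  P.real {ω | sinr β pr α l k (ofCols fun j => ghat j ω)
    (fun i => ofCols fun j => etilde (i, j) ω) ≤ γth}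

end Receiver

end Uplink

end

noncomputable section

namespace Uplink

/-! ### Characteristic functions of complex Gaussian vectors -/

/-! Almost surely the columns of Ĝ_ll are linearly independent, so g Ĝ_ll is the k-th unit row. The
pilot contamination term is then the constant C. With Z = 1/‖g‖² and Y = Σ |g · ẽ_ij|² / ‖g‖²,
dividing by ‖g‖² turns the outage event into α²(1 - γC) Z ≤ γ (Y + 1/p_r) (`sinr_le_iff`). If γC ≥
1, the left side is nonpositive and outage is almost sure.

Otherwise the joint law of (Z, Y) is needed. Z is the squared distance from column k to the span of
the other K - 1 columns (`sqNorm_pinv`). Given those columns, it is the squared norm of a Gaussian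
vector in dimension N - K + 1, because Gaussian vectors are unitarily invariant
(`map_mulVec_complexGaussianVec`). Hence Z is Erlang. Given Ĝ_ll, the products g · ẽ_ij / ‖g‖ are
independent CN(0, μ) variables, with μ the variance of ẽ_ij, whatever g is. So Y has a
hypoexponential law and is independent of Z (`measurePreserving_signal_error`).

Conditioning on Y and expanding the Erlang distribution function by the binomial theorem leaves the
moments E[Y^s e^(-aY)], a = γ/γ̄. They are the s-th derivatives at -a of the moment generating
function E[e^(tY)] = det(I - t𝒜)⁻¹. Differentiating its partial fraction expansion `charCoeff_spec`
term by term gives the factors Γ(s + q) (`integral_pow_mul_exp_hypoexponential`). -/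

instance (v : ℝ≥0) : IsProbabilityMeasure (complexGaussian v) :=
  Measure.isProbabilityMeasure_map Complex.measurableEquivRealProd.symm.measurable.aemeasurable

instance (N : ℕ) (v : ℝ≥0) : IsProbabilityMeasure (complexGaussianVec N v) := by
  unfold complexGaussianVec; infer_instance

theorem charFunDual_gaussianReal_zero (v : ℝ≥0) (L : StrongDual ℝ ℝ) :
    charFunDual (gaussianReal 0 v) L = Complex.exp (-(v * L 1 ^ 2 / 2 : ℝ)) := by
  have h : charFunDual (gaussianReal 0 v) L = charFun (gaussianReal 0 v) (L 1) := by
    rw [charFunDual_apply, charFun_apply_real]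
    refine integral_congr_ae (ae_of_all _ fun x => ?_)
    have : L x = L 1 * x := by
      have := L.map_smul x 1
      simp only [smul_eq_mul, mul_one] at this
      rw [this, mul_comm]
    simp [this]
  rw [h, charFun_gaussianReal]
  push_cast
  congr 1
  ring

theorem charFunDual_complexGaussian (v : ℝ≥0) (L : StrongDual ℝ ℂ) :
    charFunDual (complexGaussian v) L =
      Complex.exp (-(v / 4 * (L 1 ^ 2 + L Complex.I ^ 2) : ℝ)) := by
  have h : complexGaussian v = ((gaussianReal 0 (v / 2)).prod (gaussianReal 0 (v / 2))).map
      (Complex.equivRealProdCLM.symm : ℝ × ℝ →L[ℝ] ℂ) := rfl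
  rw [h, charFunDual_map, charFunDual_prod, charFunDual_gaussianReal_zero,
    charFunDual_gaussianReal_zero, ← Complex.exp_add]
  have h1 : Complex.equivRealProdCLM.symm ((1 : ℝ), (0 : ℝ)) = 1 := by
    apply Complex.ext <;> simp
  have h2 : Complex.equivRealProdCLM.symm ((0 : ℝ), (1 : ℝ)) = Complex.I := by
    apply Complex.ext <;> simp
  simp only [ContinuousLinearMap.comp_apply, ContinuousLinearMap.inl_apply,
    ContinuousLinearMap.inr_apply, ContinuousLinearEquiv.coe_coe, h1, h2]
  push_cast
  congr 1
  ring

/-- The complex coefficients of a real linear functional on `ℂ^m`: `L z = Re (∑ c_j z_j)`. -/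
def dualCoeff {m : ℕ} (L : StrongDual ℝ (Fin m → ℂ)) : Fin m → ℂ := fun j =>
  ⟨L (Pi.single j 1), -L (Pi.single j Complex.I)⟩

theorem apply_eq_re_dualCoeff {m : ℕ} (L : StrongDual ℝ (Fin m → ℂ)) (z : Fin m → ℂ) :
    L z = (dualCoeff L ⬝ᵥ z).re := by
  have hz : z = ∑ j, ((z j).re • (Pi.single j 1 : Fin m → ℂ) +
      (z j).im • (Pi.single j Complex.I : Fin m → ℂ)) := by
    ext j
    simp only [Finset.sum_apply, Pi.add_apply, Pi.smul_apply, Pi.single_apply, smul_ite, smul_zero]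
    rw [Finset.sum_eq_single j (by intro b _ hb; simp [Ne.symm hb]) (by simp)]
    apply Complex.ext <;> simp
  conv_lhs => rw [hz]
  simp only [map_sum, map_add, map_smul, smul_eq_mul, dotProduct, Complex.re_sum, Complex.mul_re,
    dualCoeff]
  refine Finset.sum_congr rfl fun j _ => by ring

theorem dualCoeff_of_apply {m : ℕ} (L : StrongDual ℝ (Fin m → ℂ)) (c : Fin m → ℂ)
    (h : ∀ z, L z = (c ⬝ᵥ z).re) : dualCoeff L = c := by
  ext j
  apply Complex.ext <;> simp [dualCoeff, h]

/-- The functional enters only through the Euclidean norm of its complex coefficients; this is the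
source of unitary invariance. The constant v/4 is half the variance v/2 of each real coordinate. -/
theorem charFunDual_complexGaussianVec {m : ℕ} (v : ℝ≥0) (L : StrongDual ℝ (Fin m → ℂ)) :
    charFunDual (complexGaussianVec m v) L =
      Complex.exp (-(v / 4 * sqNorm (dualCoeff L) : ℝ)) := by
  rw [complexGaussianVec, charFunDual_pi]
  simp only [charFunDual_complexGaussian, ← Complex.exp_sum]
  congr 1
  rw [Finset.sum_neg_distrib, ← Complex.ofReal_sum, ← Finset.mul_sum, sqNorm]
  congr 3
  refine Finset.sum_congr rfl fun j _ => ?_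
  rw [← Complex.normSq_eq_norm_sq, Complex.normSq_apply]
  simp only [ContinuousLinearMap.comp_apply, ContinuousLinearMap.single_apply, dualCoeff]
  ring

theorem sqNorm_eq_star_dotProduct {m : ℕ} (z : Fin m → ℂ) : (sqNorm z : ℂ) = star z ⬝ᵥ z := by
  simp only [sqNorm, dotProduct, Complex.ofReal_sum, Pi.star_apply, RCLike.star_def]
  refine Finset.sum_congr rfl fun j _ => ?_
  rw [← Complex.normSq_eq_conj_mul_self, Complex.normSq_eq_norm_sq]

theorem sqNorm_star {m : ℕ} (z : Fin m → ℂ) : sqNorm (star z) = sqNorm z := by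
  simp [sqNorm]

theorem sqNorm_nonneg {m : ℕ} (z : Fin m → ℂ) : 0 ≤ sqNorm z :=
  Finset.sum_nonneg fun _ _ => by positivity

theorem sqNorm_eq_zero {m : ℕ} {z : Fin m → ℂ} : sqNorm z = 0 ↔ z = 0 := by
  simp [sqNorm, Finset.sum_eq_zero_iff_of_nonneg, funext_iff]

theorem sqNorm_vecMul_of_mul_conjTranspose {m N : ℕ} {M : Matrix (Fin m) (Fin N) ℂ}
    (hM : M * Mᴴ = 1) (c : Fin m → ℂ) : sqNorm (c ᵥ* M) = sqNorm c := by
  rw [← Complex.ofReal_inj, ← sqNorm_star, ← sqNorm_star c, sqNorm_eq_star_dotProduct,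
    sqNorm_eq_star_dotProduct, star_star, star_star, Matrix.star_vecMul,
    ← Matrix.dotProduct_mulVec, Matrix.mulVec_mulVec, hM, Matrix.one_mulVec]

/-- A matrix with orthonormal rows maps a complex Gaussian vector to a complex Gaussian vector. -/
theorem map_mulVec_complexGaussianVec {m N : ℕ} {M : Matrix (Fin m) (Fin N) ℂ}
    (hM : M * Mᴴ = 1) (v : ℝ≥0) :
    (complexGaussianVec N v).map (M *ᵥ ·) = complexGaussianVec m v := by
  let A : (Fin N → ℂ) →L[ℝ] (Fin m → ℂ) :=
    LinearMap.toContinuousLinearMap (M.mulVecLin.restrictScalars ℝ)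
  change (complexGaussianVec N v).map A = _
  have : IsProbabilityMeasure ((complexGaussianVec N v).map A) :=
    Measure.isProbabilityMeasure_map A.continuous.measurable.aemeasurable
  refine Measure.ext_of_charFunDual ?_
  ext L
  -- Pulling a functional back along M replaces its coefficient row c by c M, which has the same
  -- norm since M has orthonormal rows.
  rw [charFunDual_map, charFunDual_complexGaussianVec, charFunDual_complexGaussianVec,
    dualCoeff_of_apply (L ∘SL A) (dualCoeff L ᵥ* M), sqNorm_vecMul_of_mul_conjTranspose hM]
  intro z
  rw [← Matrix.dotProduct_mulVec, ContinuousLinearMap.comp_apply, apply_eq_re_dualCoeff]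
  rfl

/-! ### Exponential functionals of the squared norm -/

/-- Squaring avoids choosing a branch of the complex square root. It costs nothing, since the real
and imaginary parts of a complex Gaussian contribute two equal factors. -/
theorem integral_cexp_mul_sq_gaussianReal {v : ℝ≥0} (hv : v ≠ 0) {w : ℂ}
    (hw : w.re * (2 * v) < 1) :
    (∫ x : ℝ, Complex.exp (w * x ^ 2) ∂gaussianReal 0 v) ^ 2 = (1 - w * (2 * v))⁻¹ := by
  have hv0 : (0 : ℝ) < v := by positivity
  have hb : 0 < (((2 * v : ℝ) : ℂ)⁻¹ - w).re := by
    rw [← Complex.ofReal_inv, Complex.sub_re, Complex.ofReal_re, sub_pos]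
    rwa [← one_div, lt_div_iff₀ (by positivity)]
  have h : ∀ x : ℝ, gaussianPDFReal 0 v x • Complex.exp (w * x ^ 2) =
      ((Real.sqrt (2 * Real.pi * v))⁻¹ : ℝ) *
        Complex.exp (-(((2 * v : ℝ) : ℂ)⁻¹ - w) * x ^ 2) := by
    intro x
    rw [gaussianPDFReal, Complex.real_smul, Complex.ofReal_mul, mul_assoc, Complex.ofReal_exp,
      ← Complex.exp_add]
    congr 2
    push_cast
    rw [sub_zero]
    ring
  rw [integral_gaussianReal_eq_integral_smul hv]
  simp_rw [h]
  rw [integral_const_mul, integral_gaussian_complex hb, mul_pow, ← Complex.ofReal_pow, inv_pow,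
    Real.sq_sqrt (by positivity), ← Complex.cpow_nat_mul]
  have hb' : ((2 * v : ℝ) : ℂ)⁻¹ - w ≠ 0 := fun h0 => by
    rw [h0] at hb
    exact lt_irrefl _ hb
  have hne : 1 - w * (2 * v) ≠ 0 := by
    intro h0
    apply hb'
    have : (v : ℂ) ≠ 0 := by exact_mod_cast hv
    push_cast
    field_simp
    linear_combination h0
  have hpi : (Real.pi : ℂ) ≠ 0 := by exact_mod_cast Real.pi_ne_zero
  have hvc : (v : ℂ) ≠ 0 := by exact_mod_cast hv
  have h2 : ((2 : ℕ) : ℂ) * (1 / 2) = 1 := by norm_num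
  rw [h2, Complex.cpow_one, eq_comm, inv_eq_iff_eq_inv]
  push_cast at hb' ⊢
  have h3 : ((2 * v : ℂ))⁻¹ - w = (1 - w * (2 * v)) / (2 * v) := by field_simp
  rw [h3]
  field_simp


/-- The parameter w is complex so as to serve twice: imaginary w identifies the Erlang law by its
characteristic function, real w gives the moment generating function of the interference. -/
theorem integral_cexp_mul_normSq {v : ℝ≥0} (hv : v ≠ 0) {w : ℂ} (hw : w.re * v < 1) :
    ∫ z, Complex.exp (w * (‖z‖ ^ 2 : ℝ)) ∂complexGaussian v = (1 - w * v)⁻¹ := by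
  rw [complexGaussian, integral_map_equiv]
  have h : ∀ p : ℝ × ℝ, Complex.exp (w * (‖Complex.measurableEquivRealProd.symm p‖ ^ 2 : ℝ)) =
      Complex.exp (w * p.1 ^ 2) * Complex.exp (w * p.2 ^ 2) := by
    intro p
    rw [← Complex.normSq_eq_norm_sq, Complex.normSq_apply, ← Complex.exp_add]
    simp
    ring_nf
  simp_rw [h]
  rw [integral_prod_mul (fun x : ℝ => Complex.exp (w * x ^ 2))
    (fun x : ℝ => Complex.exp (w * x ^ 2)), ← sq,
    integral_cexp_mul_sq_gaussianReal (by positivity)]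
  · push_cast; congr 3; ring
  · push_cast; linarith

theorem integral_cexp_mul_sum_normSq {ι : Type*} [Fintype ι] {v : ι → ℝ≥0} (hv : ∀ i, v i ≠ 0)
    {w : ℂ} (hw : ∀ i, w.re * v i < 1) :
    ∫ z : ι → ℂ, Complex.exp (w * (∑ i, ‖z i‖ ^ 2 : ℝ)) ∂Measure.pi (fun i => complexGaussian (v i))
      = ∏ i, (1 - w * v i)⁻¹ := by
  have h : ∀ z : ι → ℂ, Complex.exp (w * (∑ i, ‖z i‖ ^ 2 : ℝ)) =
      ∏ i, Complex.exp (w * (‖z i‖ ^ 2 : ℝ)) := by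
    intro z
    rw [← Complex.exp_sum, Complex.ofReal_sum, Finset.mul_sum]
  simp_rw [h]
  rw [integral_fintype_prod_eq_prod (fun i (z : ℂ) => Complex.exp (w * (‖z‖ ^ 2 : ℝ)))]
  exact Finset.prod_congr rfl fun i _ => integral_cexp_mul_normSq (hv i) (hw i)

/-! ### The Erlang distribution -/

theorem integrableOn_pow_mul_cexp_neg_mul {c : ℂ} (hc : 0 < c.re) (n : ℕ) :
    IntegrableOn (fun x : ℝ => (x : ℂ) ^ n * Complex.exp (-(c * x))) (Set.Ioi 0) := by
  have h := integrableOn_rpow_mul_exp_neg_mul_rpow (s := n) (p := 1) (b := c.re)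
    (by have : (0 : ℝ) ≤ n := n.cast_nonneg
        linarith) (by norm_num) hc
  refine h.mono' (by fun_prop) ?_
  filter_upwards [ae_restrict_mem measurableSet_Ioi] with x hx
  have hx' : (0 : ℝ) < x := hx
  rw [norm_mul, norm_pow, Complex.norm_real, Complex.norm_exp, Real.rpow_natCast, Real.rpow_one,
    Real.norm_of_nonneg hx'.le]
  simp

/-- Induction on n by parts: the derivative of x^(n+1) e^(-cx) has integral zero over the half-line.
This needs no contour shift for complex c. -/
theorem integral_pow_mul_cexp_neg_mul {c : ℂ} (hc : 0 < c.re) (n : ℕ) :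
    ∫ x in Set.Ioi (0 : ℝ), (x : ℂ) ^ n * Complex.exp (-(c * x)) = n.factorial / c ^ (n + 1) := by
  have hc0 : c ≠ 0 := fun h => by simp [h] at hc
  have hexp : ∀ x : ℝ, HasDerivAt (fun x : ℝ => Complex.exp (-(c * x)))
      (-c * Complex.exp (-(c * x))) x := by
    intro x
    have h0 : HasDerivAt (fun x : ℝ => -(c * (x : ℂ))) (-c) x :=
      ((Complex.ofRealCLM.hasDerivAt (x := x)).const_mul c).neg.congr_deriv (by simp)
    simpa [mul_comm] using h0.cexp
  have hlim : ∀ n : ℕ, Filter.Tendsto (fun x : ℝ => (x : ℂ) ^ n * Complex.exp (-(c * x)))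
      Filter.atTop (nhds 0) := by
    intro n
    rw [tendsto_zero_iff_norm_tendsto_zero]
    have := tendsto_rpow_mul_exp_neg_mul_atTop_nhds_zero n c.re hc
    refine this.congr' ?_
    filter_upwards [Filter.eventually_gt_atTop 0] with x hx
    rw [norm_mul, norm_pow, Complex.norm_real, Complex.norm_exp, Real.rpow_natCast,
      Real.norm_of_nonneg hx.le]
    simp
  induction n with
  | zero =>
    have h := integral_Ioi_of_hasDerivAt_of_tendsto' (a := (0 : ℝ)) (fun x _ => hexp x)
      (by
        have := (integrableOn_pow_mul_cexp_neg_mul hc 0).const_mul (-c)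
        simp only [pow_zero, one_mul] at this
        exact this)
      (by simpa using hlim 0)
    rw [integral_const_mul] at h
    simp only [pow_zero, one_mul, Nat.factorial_zero, Nat.cast_one, zero_add, pow_one]
    rw [eq_div_iff hc0]
    simp only [Complex.ofReal_zero, mul_zero, neg_zero, Complex.exp_zero] at h
    linear_combination -h
  | succ n ih =>
    have hd : ∀ x : ℝ, HasDerivAt (fun x : ℝ => (x : ℂ) ^ (n + 1) * Complex.exp (-(c * x)))
        ((n + 1) * ((x : ℂ) ^ n * Complex.exp (-(c * x))) -
          c * ((x : ℂ) ^ (n + 1) * Complex.exp (-(c * x)))) x := by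
      intro x
      have h1 : HasDerivAt (fun x : ℝ => (x : ℂ) ^ (n + 1)) ((n + 1) * (x : ℂ) ^ n) x :=
        ((Complex.ofRealCLM.hasDerivAt (x := x)).pow (n + 1)).congr_deriv (by simp)
      exact (h1.mul (hexp x)).congr_deriv (by ring)
    have i1 := (integrableOn_pow_mul_cexp_neg_mul hc n).const_mul ((n : ℂ) + 1)
    have i2 := (integrableOn_pow_mul_cexp_neg_mul hc (n + 1)).const_mul c
    have h := integral_Ioi_of_hasDerivAt_of_tendsto' (a := (0 : ℝ)) (fun x _ => hd x)
      (i1.sub i2) (hlim (n + 1))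
    rw [integral_sub i1 i2, integral_const_mul, integral_const_mul, ih] at h
    rw [eq_div_iff (pow_ne_zero _ hc0)]
    rw [Nat.factorial_succ]
    push_cast
    simp at h
    field_simp at h
    linear_combination -h

theorem gammaPDFReal_succ (n : ℕ) (r : ℝ) {x : ℝ} (hx : 0 ≤ x) :
    gammaPDFReal (n + 1) r x =
      r ^ (n + 1) / n.factorial * (x ^ n * Real.exp (-(r * x))) := by
  rw [gammaPDFReal, if_pos hx, Real.Gamma_nat_eq_factorial, add_sub_cancel_right,
    Real.rpow_natCast]
  norm_cast
  ring

theorem charFun_gammaMeasure (n : ℕ) {r : ℝ} (hr : 0 < r) (t : ℝ) :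
    charFun (gammaMeasure (n + 1) r) t = (1 - t * Complex.I / r)⁻¹ ^ (n + 1) := by
  have hc : 0 < ((r : ℂ) - t * Complex.I).re := by simpa using hr
  have hc0 : (r : ℂ) - t * Complex.I ≠ 0 := fun h => by simp [h] at hc
  have hr0 : (r : ℂ) ≠ 0 := by exact_mod_cast hr.ne'
  have hm : Measurable (gammaPDFReal (n + 1) r) := measurable_gammaPDFReal _ _
  rw [charFun_apply_real, gammaMeasure]
  have h1 : ∫ x, Complex.exp (t * x * Complex.I) ∂volume.withDensity (gammaPDF (n + 1) r) =
      ∫ x, gammaPDFReal (n + 1) r x • Complex.exp (t * x * Complex.I) := by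
    have := integral_withDensity_eq_integral_toReal_smul (μ := volume)
      (f := gammaPDF (n + 1) r) hm.ennreal_ofReal
      (ae_of_all _ fun x => ENNReal.ofReal_lt_top)
      (fun x : ℝ => Complex.exp (t * x * Complex.I))
    rw [this]
    refine integral_congr_ae (ae_of_all _ fun x => ?_)
    simp only [gammaPDF]
    rw [ENNReal.toReal_ofReal (gammaPDFReal_nonneg (by positivity) hr x)]
  have h2 : ∀ x : ℝ, x ∉ Set.Ici 0 →
      gammaPDFReal (n + 1) r x • Complex.exp (t * x * Complex.I) = 0 := by
    intro x hx
    rw [gammaPDFReal, if_neg (by simpa using hx), zero_smul]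
  have h3 : ∀ x ∈ Set.Ioi (0 : ℝ), gammaPDFReal (n + 1) r x • Complex.exp (t * x * Complex.I) =
      (r ^ (n + 1) / n.factorial : ℂ) *
        ((x : ℂ) ^ n * Complex.exp (-((r - t * Complex.I) * x))) := by
    intro x hx
    rw [gammaPDFReal_succ n r (le_of_lt hx), Complex.real_smul]
    push_cast
    rw [mul_assoc, mul_assoc, ← Complex.exp_add]
    ring_nf
  rw [h1, ← setIntegral_eq_integral_of_forall_compl_eq_zero h2, integral_Ici_eq_integral_Ioi,
    setIntegral_congr_fun measurableSet_Ioi h3, integral_const_mul,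
    integral_pow_mul_cexp_neg_mul hc]
  have : (n.factorial : ℂ) ≠ 0 := by exact_mod_cast n.factorial_ne_zero
  have h4 : (1 - t * Complex.I / r) = ((r : ℂ) - t * Complex.I) / r := by field_simp
  rw [h4, inv_div, div_pow]
  field_simp

theorem measurable_sqNorm {m : ℕ} : Measurable (sqNorm (m := m)) := by
  unfold sqNorm; fun_prop

/-- The squared norm of a complex Gaussian vector is Erlang distributed. -/
theorem map_sqNorm_complexGaussianVec (n : ℕ) {v : ℝ≥0} (hv : v ≠ 0) :
    (complexGaussianVec (n + 1) v).map sqNorm = gammaMeasure (n + 1) (v : ℝ)⁻¹ := by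
  have hv0 : (0 : ℝ) < v := by positivity
  have := isProbabilityMeasure_gammaMeasure (a := (n : ℝ) + 1) (r := (v : ℝ)⁻¹) (by positivity)
    (by positivity)
  refine Measure.ext_of_charFun ?_
  ext t
  rw [charFun_gammaMeasure n (by positivity), charFun_apply_real,
    integral_map measurable_sqNorm.aemeasurable (by fun_prop)]
  have h := integral_cexp_mul_sum_normSq (ι := Fin (n + 1)) (v := fun _ => v) (fun _ => hv)
    (w := t * Complex.I) (fun _ => by simp)
  rw [Finset.prod_const, Finset.card_univ, Fintype.card_fin] at h
  rw [complexGaussianVec]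
  convert h using 3 with z
  · rw [sqNorm]
    ring_nf
  · simp

/-- Differentiating e^(-rx) times the truncated exponential series telescopes, leaving only the top
term, which is minus the Erlang density. -/
theorem gammaMeasure_Iic (n : ℕ) {r : ℝ} (hr : 0 < r) {z : ℝ} (hz : 0 ≤ z) :
    (gammaMeasure (n + 1) r).real (Set.Iic z) =
      1 - Real.exp (-(r * z)) * ∑ t ∈ Finset.range (n + 1), (r * z) ^ t / t.factorial := by
  have hpos : (0 : ℝ) < n + 1 := by positivity
  have := isProbabilityMeasure_gammaMeasure hpos hr
  rw [← cdf_eq_real, cdf_gammaMeasure_eq_integral hpos hr]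
  have h2 : ∀ x ∈ Set.Iic z \ Set.Icc 0 z, gammaPDFReal (n + 1) r x = 0 := by
    intro x hx
    rw [gammaPDFReal, if_neg]
    intro h
    exact hx.2 ⟨h, hx.1⟩
  rw [setIntegral_eq_of_subset_of_forall_sdiff_eq_zero measurableSet_Iic Set.Icc_subset_Iic_self
    h2, integral_Icc_eq_integral_Ioc, ← intervalIntegral.integral_of_le hz]
  have hsum : ∀ (n : ℕ) (x : ℝ), HasDerivAt
      (fun x => ∑ t ∈ Finset.range (n + 1), (r * x) ^ t / t.factorial)
      (r * ∑ t ∈ Finset.range n, (r * x) ^ t / t.factorial) x := by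
    intro n x
    induction n with
    | zero => simpa using hasDerivAt_const x (1 : ℝ)
    | succ n ih =>
      simp_rw [Finset.sum_range_succ _ (n + 1)]
      rw [Finset.sum_range_succ _ n, mul_add]
      refine ih.add ?_
      have := (((hasDerivAt_id x).const_mul r).pow (n + 1)).div_const ((n + 1).factorial : ℝ)
      refine this.congr_deriv ?_
      rw [Nat.factorial_succ]
      push_cast
      have : (n.factorial : ℝ) ≠ 0 := by positivity
      simp
      field_simp
  have hd : ∀ x ∈ Set.uIcc 0 z, HasDerivAt (fun x => -(Real.exp (-(r * x)) *
      ∑ t ∈ Finset.range (n + 1), (r * x) ^ t / t.factorial)) (gammaPDFReal (n + 1) r x) x := by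
    intro x hx
    rw [Set.uIcc_of_le hz] at hx
    rw [gammaPDFReal_succ n r hx.1]
    have h1 : HasDerivAt (fun x => Real.exp (-(r * x))) (Real.exp (-(r * x)) * (-r)) x := by
      have := ((hasDerivAt_id x).const_mul r).neg.exp
      simpa using this
    refine (h1.mul (hsum n x)).neg.congr_deriv ?_
    rw [Finset.sum_range_succ]
    ring
  have hint : IntervalIntegrable (gammaPDFReal (n + 1) r) volume 0 z := by
    have : IntervalIntegrable (fun x => r ^ (n + 1) / n.factorial *
        (x ^ n * Real.exp (-(r * x)))) volume 0 z :=
      Continuous.intervalIntegrable (by fun_prop) _ _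
    refine this.congr ?_
    intro x hx
    rw [Set.uIoc_of_le hz] at hx
    exact (gammaPDFReal_succ n r hx.1.le).symm
  rw [intervalIntegral.integral_eq_sub_of_hasDerivAt hd hint]
  have h0 : ∑ t ∈ Finset.range (n + 1), (r * (0 : ℝ)) ^ t / t.factorial = 1 := by
    rw [Finset.sum_eq_single_of_mem 0 (by simp)]
    · simp
    · intro b _ hb; simp [hb]
  rw [h0]
  simp
  ring

/-! ### Linear algebra of the zero-forcing receiver -/

theorem linearIndependent_insertNth {V : Type*} [AddCommGroup V] [Module ℂ V] {n : ℕ}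
    (k : Fin (n + 1)) (x : V) (v : Fin n → V) :
    LinearIndependent ℂ (k.insertNth (α := fun _ => V) x v) ↔
      LinearIndependent ℂ v ∧ x ∉ Submodule.span ℂ (Set.range v) := by
  rw [← linearIndependent_option', ← linearIndependent_equiv (finSuccEquiv' k)]
  have : (k.insertNth (α := fun _ => V) x v) =
      (fun o => Option.casesOn' o x v : Option (Fin n) → V) ∘ finSuccEquiv' k := by
    ext1 j
    refine Fin.succAboveCases k ?_ (fun j => ?_) j <;> simp
  rw [this]

/-- A subspace of `ℂ^N` of codimension `m` is the kernel of a matrix with `m` orthonormal rows. -/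
theorem exists_orthonormal_rows {N m : ℕ} (W : Submodule ℂ (Fin N → ℂ))
    (hW : Module.finrank ℂ W + m = N) :
    ∃ M : Matrix (Fin m) (Fin N) ℂ, M * Mᴴ = 1 ∧ (∀ w ∈ W, M *ᵥ w = 0) ∧
      ∀ x, x - Mᴴ *ᵥ (M *ᵥ x) ∈ W := by
  let e := (WithLp.linearEquiv 2 ℂ (Fin N → ℂ)).symm
  let W' : Submodule ℂ (EuclideanSpace ℂ (Fin N)) := W.map e.toLinearMap
  have hfin : Module.finrank ℂ W'ᗮ = m := by
    have h1 := W'.finrank_add_finrank_orthogonal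
    have h2 : Module.finrank ℂ W' = Module.finrank ℂ W := LinearEquiv.finrank_map_eq e W
    rw [h2, finrank_euclideanSpace_fin] at h1
    omega
  let b : OrthonormalBasis (Fin m) ℂ W'ᗮ := (stdOrthonormalBasis ℂ W'ᗮ).reindex (finCongr hfin)
  let M : Matrix (Fin m) (Fin N) ℂ :=
    Matrix.of fun i a => star ((b i : EuclideanSpace ℂ (Fin N)) a)
  have hMx : ∀ (x : Fin N → ℂ) i,
      (M *ᵥ x) i = inner ℂ (b i : EuclideanSpace ℂ (Fin N)) (e x) := by
    intro x i
    rw [EuclideanSpace.inner_eq_star_dotProduct, dotProduct_comm]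
    rfl
  have hMH : ∀ u : Fin m → ℂ, e (Mᴴ *ᵥ u) = ∑ i, u i • (b i : EuclideanSpace ℂ (Fin N)) := by
    intro u
    ext a
    simp [e, M, Matrix.mulVec, dotProduct, mul_comm]
  refine ⟨M, ?_, ?_, ?_⟩
  · ext i j
    have h := orthonormal_iff_ite.1 b.orthonormal i j
    rw [Submodule.coe_inner, EuclideanSpace.inner_eq_star_dotProduct, dotProduct_comm] at h
    rw [Matrix.one_apply, ← h]
    simp [M, Matrix.mul_apply, dotProduct]
  · intro w hw
    ext i
    rw [hMx]
    exact Submodule.inner_left_of_mem_orthogonal (Submodule.mem_map_of_mem hw) (b i).2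
  · intro x
    have h : e (x - Mᴴ *ᵥ (M *ᵥ x)) ∈ W' := by
      -- Membership in W' is tested against its orthogonal complement, where Mᴴ M is the expansion
      -- in the orthonormal basis b.
      rw [← W'.orthogonal_orthogonal, map_sub, hMH, Submodule.mem_orthogonal]
      intro u hu
      have hsum := congrArg (fun z : W'ᗮ => (z : EuclideanSpace ℂ (Fin N))) (b.sum_repr' ⟨u, hu⟩)
      simp only [Submodule.coe_inner] at hsum
      rw [inner_sub_right, sub_eq_zero, ← hsum]
      simp only [AddSubmonoidClass.coe_finsetSum, Submodule.coe_smul, sum_inner, inner_smul_left]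
      refine Finset.sum_congr rfl fun i _ => ?_
      rw [inner_sum]
      have hb : ∀ j, inner ℂ (b i : EuclideanSpace ℂ (Fin N)) (b j : EuclideanSpace ℂ (Fin N)) =
          if i = j then 1 else 0 := orthonormal_iff_ite.1 b.orthonormal i
      simp [inner_smul_right, hb, hMx]
    obtain ⟨w, hw, hwe⟩ := h
    rwa [← e.injective hwe]

section Receiver

variable {N K : ℕ}

theorem range_mulVecLin_ofCols (c : Fin K → Fin N → ℂ) :
    LinearMap.range (ofCols c).mulVecLin = Submodule.span ℂ (Set.range c) := by
  rw [Matrix.range_mulVecLin]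
  rfl

theorem isUnit_det_gram {c : Fin K → Fin N → ℂ} (hc : LinearIndependent ℂ c) :
    IsUnit ((ofCols c)ᴴ * ofCols c).det := by
  have hinj : Function.Injective (ofCols c).mulVec := by
    rw [Matrix.mulVec_injective_iff]
    exact hc
  open scoped ComplexOrder in
  exact (Matrix.PosDef.conjTranspose_mul_self (ofCols c) hinj).isUnit.map Matrix.detMonoidHom

theorem pinv_mul_self {c : Fin K → Fin N → ℂ} (hc : LinearIndependent ℂ c) :
    pinv (ofCols c) * ofCols c = 1 := by
  rw [pinv, Matrix.mul_assoc, Matrix.nonsing_inv_mul _ (isUnit_det_gram hc)]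

/-- The squared norm of a row of the pseudo-inverse is the inverse of the squared distance of the
corresponding column from the span of the others. -/
theorem sqNorm_pinv {m : ℕ} {c : Fin K → Fin N → ℂ} (hc : LinearIndependent ℂ c) (k : Fin K)
    {M : Matrix (Fin m) (Fin N) ℂ} (hM : M * Mᴴ = 1) (hM0 : ∀ j, j ≠ k → M *ᵥ c j = 0)
    (hspan : c k - Mᴴ *ᵥ (M *ᵥ c k) ∈ Submodule.span ℂ (c '' {k}ᶜ)) :
    0 < sqNorm (M *ᵥ c k) ∧ sqNorm (pinv (ofCols c) k) = (sqNorm (M *ᵥ c k))⁻¹ := by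
  set s := sqNorm (M *ᵥ c k) with hs
  have hs0 : 0 < s := by
    -- If s = 0, column k would lie in the span of the others.
    refine lt_of_le_of_ne (sqNorm_nonneg _) fun h => ?_
    rw [sqNorm_eq_zero.1 h.symm, Matrix.mulVec_zero, sub_zero] at hspan
    exact hc.notMem_span_image (by simp) hspan
  refine ⟨hs0, ?_⟩
  set G := ofCols c with hG
  -- y is the component of column k orthogonal to the other columns. It lies in the column space and
  -- Gᴴ y = s e_k, so y = G (Gᴴ G)⁻¹ Gᴴ y is s times the conjugate of row k of the pseudo-inverse.
  -- Comparing norms gives s = s² ‖g‖².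
  set y := Mᴴ *ᵥ (M *ᵥ c k) with hy
  have hyG : y ∈ LinearMap.range G.mulVecLin := by
    rw [range_mulVecLin_ofCols]
    have h1 : c k ∈ Submodule.span ℂ (Set.range c) := Submodule.subset_span ⟨k, rfl⟩
    have h2 := Submodule.span_mono (R := ℂ) (Set.image_subset_range c {k}ᶜ) hspan
    simpa using Submodule.sub_mem _ h1 h2
  obtain ⟨a, ha⟩ := hyG
  have ha : G *ᵥ a = y := ha
  have hGy : Gᴴ *ᵥ y = Pi.single k (s : ℂ) := by
    ext j
    have h1 : (Gᴴ *ᵥ y) j = star (M *ᵥ c j) ⬝ᵥ (M *ᵥ c k) := by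
      rw [Matrix.star_mulVec, ← Matrix.dotProduct_mulVec]
      rfl
    rw [h1]
    rcases eq_or_ne j k with rfl | hj
    · rw [Pi.single_eq_same, hs, sqNorm_eq_star_dotProduct]
    · rw [hM0 j hj, Pi.single_eq_of_ne hj]
      simp
  have hpy : pinv G *ᵥ y = a := by
    rw [← ha, Matrix.mulVec_mulVec, pinv_mul_self hc, Matrix.one_mulVec]
  have hH : ((Gᴴ * G)⁻¹)ᴴ = (Gᴴ * G)⁻¹ :=
    (Matrix.isHermitian_conjTranspose_mul_self G).inv
  have hy2 : y = (s : ℂ) • star (pinv G k) := by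
    rw [← ha, ← hpy, pinv, ← Matrix.mulVec_mulVec, hGy, Matrix.mulVec_mulVec]
    ext i
    have h1 : ((s : ℂ) • star (pinv G k)) i = (s : ℂ) * (pinv G)ᴴ i k := rfl
    have h2 : (pinv G)ᴴ = G * (Gᴴ * G)⁻¹ := by
      rw [pinv, Matrix.conjTranspose_mul, Matrix.conjTranspose_conjTranspose, hH]
    change _ = ((s : ℂ) • star (pinv G k)) i
    rw [h1, h2, Matrix.mulVec_single]
    exact mul_comm _ _
  have hy3 : sqNorm y = s := by
    rw [hy, ← sqNorm_star, Matrix.star_mulVec, Matrix.conjTranspose_conjTranspose,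
      sqNorm_vecMul_of_mul_conjTranspose hM, sqNorm_star]
  have hy4 : sqNorm y = s ^ 2 * sqNorm (pinv G k) := by
    rw [hy2, ← sqNorm_star (pinv G k)]
    simp [sqNorm, Finset.mul_sum, mul_pow]
  rw [hy3] at hy4
  refine eq_inv_of_mul_eq_one_left (mul_left_cancel₀ hs0.ne' ?_)
  linarith

/-- Zero forcing cancels every column but the k-th, and the contaminated estimates are column
rescalings of Ĝ_ll; what survives is deterministic. -/
theorem vecMul_crossEstimate {L : ℕ} {c : Fin K → Fin N → ℂ} (hc : LinearIndependent ℂ c)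
    (k : Fin K) (β : Fin L → Fin L → Fin K → ℝ) (l i : Fin L) :
    sqNorm (pinv (ofCols c) k ᵥ* crossEstimate β l i (ofCols c)) =
      (β l i k / β l l k) ^ 2 := by
  have h : pinv (ofCols c) k ᵥ* crossEstimate β l i (ofCols c) =
      Pi.single k ((β l i k / β l l k : ℝ) : ℂ) := by
    have h1 : pinv (ofCols c) k = Pi.single k 1 ᵥ* pinv (ofCols c) := by
      rw [Matrix.single_one_vecMul]; rfl
    rw [h1, Matrix.vecMul_vecMul, crossEstimate, ← Matrix.mul_assoc, pinv_mul_self hc,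
      Matrix.one_mul, Matrix.single_one_vecMul]
    ext j
    rcases eq_or_ne j k with rfl | hj
    · simp
    · simp [hj, Matrix.diagonal_apply_ne _ hj.symm]
  rw [h, sqNorm, Finset.sum_eq_single k (by intro j _ hj; simp [hj]) (by simp)]
  rw [Pi.single_eq_same, Complex.norm_real, Real.norm_eq_abs, sq_abs]

end Receiver

/-! ### Laws of the desired signal power and of the interference -/

/-- Writing the inverse as adjugate over determinant gives measurability everywhere, including
singular Gram matrices, where inversion takes the value 0. -/
theorem measurable_pinv {N K : ℕ} (k : Fin K) (a : Fin N) :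
    Measurable fun c : Fin K → Fin N → ℂ => pinv (ofCols c) k a := by
  have hG : Continuous fun c : Fin K → Fin N → ℂ => ofCols c :=
    continuous_matrix fun a j => by simp only [ofCols, Matrix.of_apply]; fun_prop
  have hGram : Continuous fun c : Fin K → Fin N → ℂ => (ofCols c)ᴴ * ofCols c :=
    hG.matrix_conjTranspose.matrix_mul hG
  have hdet := hGram.matrix_det.measurable
  have hadj := hGram.matrix_adjugate
  simp only [pinv, Matrix.inv_def, Ring.inverse_eq_inv', Matrix.smul_mul]
  exact hdet.inv.mul ((hadj.matrix_mul hG.matrix_conjTranspose).matrix_elem k a).measurable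

theorem measurable_pinv_row {N K : ℕ} (k : Fin K) :
    Measurable fun c : Fin K → Fin N → ℂ => pinv (ofCols c) k :=
  measurable_pi_lambda _ fun a => measurable_pinv k a

theorem sqNorm_pinv_pos {N K : ℕ} {c : Fin K → Fin N → ℂ} (hc : LinearIndependent ℂ c)
    (k : Fin K) : 0 < sqNorm (pinv (ofCols c) k) := by
  refine lt_of_le_of_ne (sqNorm_nonneg _) fun h => ?_
  have h0 := sqNorm_eq_zero.1 h.symm
  have h1 := congrFun (congrFun (pinv_mul_self hc) k) k
  rw [Matrix.mul_apply_eq_vecMul, h0] at h1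
  simp at h1

/-- On W the component orthogonal to W vanishes, but its squared norm has an Erlang law, which has
no atom at 0. -/
theorem complexGaussianVec_submodule {N : ℕ} {v : ℝ≥0} (hv : v ≠ 0)
    (W : Submodule ℂ (Fin N → ℂ)) (hW : Module.finrank ℂ W < N) :
    complexGaussianVec N v W = 0 := by
  obtain ⟨n, hn⟩ : ∃ n, Module.finrank ℂ W + (n + 1) = N := ⟨N - Module.finrank ℂ W - 1, by omega⟩
  obtain ⟨M, hM, hMW, -⟩ := exists_orthonormal_rows W hn
  have hmeas : Measurable fun x : Fin N → ℂ => M *ᵥ x := by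
    exact (Continuous.matrix_mulVec continuous_const continuous_id).measurable
  have h : (complexGaussianVec N v).map (fun x => sqNorm (M *ᵥ x)) {0} = 0 := by
    rw [← Function.comp_def, ← Measure.map_map measurable_sqNorm hmeas,
      map_mulVec_complexGaussianVec hM, map_sqNorm_complexGaussianVec n hv]
    exact withDensity_absolutelyContinuous _ _ (measure_singleton 0)
  have hcomp : Measurable fun x : Fin N → ℂ => sqNorm (M *ᵥ x) := measurable_sqNorm.comp hmeas
  rw [Measure.map_apply hcomp (measurableSet_singleton 0)] at h
  refine measure_mono_null (fun x hx => ?_) h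
  simp [hMW x hx, sqNorm_eq_zero]

theorem measurableSet_linearIndependent_insertNth {N n : ℕ} (k : Fin (n + 1)) :
    MeasurableSet {p : (Fin N → ℂ) × (Fin n → Fin N → ℂ) |
      LinearIndependent ℂ (k.insertNth (α := fun _ => Fin N → ℂ) p.1 p.2)} := by
  have h : IsOpen {f : Fin (n + 1) → Fin N → ℂ | LinearIndependent ℂ f} :=
    isOpen_setOfPred_linearIndependent
  exact (MeasurableEquiv.piFinSuccAbove (fun _ => Fin N → ℂ) k).symm.measurable h.measurableSet

theorem ae_linearIndependent_insertNth {N n : ℕ} (hn : n < N) {v : ℝ≥0} (hv : v ≠ 0)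
    {c : Fin n → Fin N → ℂ} (hc : LinearIndependent ℂ c) (k : Fin (n + 1)) :
    ∀ᵐ x ∂complexGaussianVec N v,
      LinearIndependent ℂ (k.insertNth (α := fun _ => Fin N → ℂ) x c) := by
  simp_rw [linearIndependent_insertNth, hc, true_and]
  have := complexGaussianVec_submodule hv (Submodule.span ℂ (Set.range c))
    (by rwa [finrank_span_eq_card hc, Fintype.card_fin])
  exact measure_eq_zero_iff_ae_notMem.1 this

/-- At most `N` independent nondegenerate complex Gaussian vectors of `ℂ^N` are almost surely
linearly independent. -/
theorem ae_linearIndependent {N n : ℕ} (hn : n ≤ N) (v : Fin n → ℝ≥0) (hv : ∀ j, v j ≠ 0) :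
    ∀ᵐ c ∂Measure.pi (fun j => complexGaussianVec N (v j)), LinearIndependent ℂ c := by
  induction n with
  | zero => exact ae_of_all _ fun c => linearIndependent_empty_type
  | succ n ih =>
    have mp := measurePreserving_piFinSuccAbove (fun j => complexGaussianVec N (v j)) 0
    have h : ∀ᵐ p ∂(complexGaussianVec N (v 0)).prod
        (Measure.pi fun j => complexGaussianVec N (v ((0 : Fin (n + 1)).succAbove j))),
        LinearIndependent ℂ (Fin.insertNth (α := fun _ => Fin N → ℂ) 0 p.1 p.2) := by
      have hmeas := measurableSet_linearIndependent_insertNth (N := N) (0 : Fin (n + 1))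
      rw [Measure.ae_prod_iff_ae_ae hmeas, Measure.ae_ae_comm hmeas]
      -- The quantifiers have been exchanged: the other columns are fixed first, and column 0 then
      -- avoids their span.
      filter_upwards [ih (by omega) (fun j => v ((0 : Fin (n + 1)).succAbove j))
        (fun j => hv _)] with c hc
      exact ae_linearIndependent_insertNth (by omega) (hv 0) hc 0
    filter_upwards [mp.quasiMeasurePreserving.ae h] with c hc
    have : Fin.insertNth (α := fun _ => Fin N → ℂ) 0 (c 0)
        (fun j => c ((0 : Fin (n + 1)).succAbove j)) = c := Fin.insertNth_self_removeNth 0 c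
    rw [← this]
    exact hc

/-- The inverse squared norm of a row of the pseudo-inverse of a Gaussian matrix is Erlang
distributed. -/
theorem measurePreserving_inv_sqNorm_pinv {N K n : ℕ} (hN : K + (n + 1) = N)
    (v : Fin (K + 1) → ℝ≥0) (hv : ∀ j, v j ≠ 0) (k : Fin (K + 1)) :
    MeasurePreserving (fun c : Fin (K + 1) → Fin N → ℂ => (sqNorm (pinv (ofCols c) k))⁻¹)
      (Measure.pi fun j => complexGaussianVec N (v j)) (gammaMeasure (n + 1) (v k : ℝ)⁻¹) := by
  set μO := Measure.pi fun j => complexGaussianVec N (v (k.succAbove j)) with hμO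
  let h : (Fin (K + 1) → Fin N → ℂ) → ℝ := fun c => (sqNorm (pinv (ofCols c) k))⁻¹
  have hh : Measurable h := (measurable_sqNorm.comp (measurable_pinv_row k)).inv
  let e := MeasurableEquiv.piFinSuccAbove (fun _ : Fin (K + 1) => Fin N → ℂ) k
  have mp : MeasurePreserving e (Measure.pi fun j => complexGaussianVec N (v j))
      ((complexGaussianVec N (v k)).prod μO) :=
    measurePreserving_piFinSuccAbove (fun j => complexGaussianVec N (v j)) k
  let g : (Fin K → Fin N → ℂ) → (Fin N → ℂ) → ℝ := fun o x => h (e.symm (x, o))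
  have hg : Measurable (Function.uncurry g) :=
    hh.comp (e.symm.measurable.comp measurable_swap)
  -- Given the other columns o, the matrix M projects off their K-dimensional span; the resulting
  -- law depends only on the codimension n + 1, not on o.
  have hlaw : ∀ᵐ o ∂μO, (complexGaussianVec N (v k)).map (g o) =
      gammaMeasure (n + 1) (v k : ℝ)⁻¹ := by
    filter_upwards [ae_linearIndependent (N := N) (by omega) (fun j => v (k.succAbove j))
      (fun j => hv _)] with o ho
    obtain ⟨M, hM, hMW, hMspan⟩ := exists_orthonormal_rows (m := n + 1)
      (Submodule.span ℂ (Set.range o)) (by rwa [finrank_span_eq_card ho, Fintype.card_fin])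
    have hmeas : Measurable fun x : Fin N → ℂ => M *ᵥ x :=
      (Continuous.matrix_mulVec continuous_const continuous_id).measurable
    have hae : g o =ᵐ[complexGaussianVec N (v k)] fun x => sqNorm (M *ᵥ x) := by
      filter_upwards [ae_linearIndependent_insertNth (by omega) (hv k) ho k] with x hx
      have hk : k.insertNth (α := fun _ => Fin N → ℂ) x o k = x := Fin.insertNth_apply_same ..
      have := (sqNorm_pinv hx k hM (fun j hj => ?_) ?_).2
      · change (sqNorm (pinv (ofCols (k.insertNth (α := fun _ => Fin N → ℂ) x o)) k))⁻¹ = _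
        rw [this, hk, inv_inv]
      · obtain ⟨i, rfl⟩ := Fin.exists_succAbove_eq hj
        rw [Fin.insertNth_apply_succAbove]
        exact hMW _ (Submodule.subset_span ⟨i, rfl⟩)
      · rw [hk]
        refine Submodule.span_mono ?_ (hMspan x)
        rintro _ ⟨i, rfl⟩
        exact ⟨k.succAbove i, Fin.succAbove_ne k i, Fin.insertNth_apply_succAbove ..⟩
    rw [Measure.map_congr hae, ← Function.comp_def, ← Measure.map_map measurable_sqNorm hmeas,
      map_mulVec_complexGaussianVec hM, map_sqNorm_complexGaussianVec n (hv k)]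
  have : IsProbabilityMeasure (gammaMeasure ((n : ℝ) + 1) (v k : ℝ)⁻¹) :=
    isProbabilityMeasure_gammaMeasure (by positivity) (inv_pos.2 (by have := hv k; positivity))
  -- A conditional law that does not depend on o is also the unconditional law.
  have key := measurePreserving_snd.comp
    (((MeasurePreserving.id μO).skew_product hg hlaw).comp (Measure.measurePreserving_swap.comp mp))
  convert key using 1
  ext c
  exact congrArg h (e.symm_apply_apply c).symm

/-- The normalized g is a 1 × N matrix with orthonormal row, so unitary invariance applies to each
vector separately. -/
theorem map_normalized_dotProduct {ι : Type*} [Fintype ι] {N : ℕ} (v : ι → ℝ≥0)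
    {g : Fin N → ℂ} (hg : 0 < sqNorm g) :
    (Measure.pi fun i => complexGaussianVec N (v i)).map
        (fun e i => ((Real.sqrt (sqNorm g))⁻¹ : ℝ) * (g ⬝ᵥ e i)) =
      Measure.pi fun i => complexGaussian (v i) := by
  let M : Matrix (Fin 1) (Fin N) ℂ :=
    Matrix.of fun _ a => ((Real.sqrt (sqNorm g))⁻¹ : ℝ) * g a
  have hM : M * Mᴴ = 1 := by
    ext i j
    rw [Subsingleton.elim j i, Matrix.one_apply_eq, Matrix.mul_apply]
    have h1 : ∀ a, M i a * Mᴴ a i = ((sqNorm g)⁻¹ : ℝ) * ((‖g a‖ ^ 2 : ℝ) : ℂ) := by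
      intro a
      rw [Matrix.conjTranspose_apply, RCLike.star_def, ← Complex.normSq_eq_conj_mul_self.trans
        (mul_comm _ _), Complex.normSq_eq_norm_sq]
      simp only [M, Matrix.of_apply]
      rw [norm_mul, mul_pow, Complex.norm_real, Real.norm_eq_abs, sq_abs, inv_pow,
        Real.sq_sqrt hg.le, Complex.ofReal_mul]
    simp_rw [h1]
    rw [← Finset.mul_sum, ← Complex.ofReal_sum, ← sqNorm, ← Complex.ofReal_mul,
      inv_mul_cancel₀ hg.ne', Complex.ofReal_one]
  have hmeas : Measurable fun x : Fin N → ℂ => M *ᵥ x :=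
    (Continuous.matrix_mulVec continuous_const continuous_id).measurable
  have hlaw : ∀ u : ℝ≥0, (complexGaussianVec N u).map
      (fun x => ((Real.sqrt (sqNorm g))⁻¹ : ℝ) * (g ⬝ᵥ x)) = complexGaussian u := by
    intro u
    have h2 : (fun x => ((Real.sqrt (sqNorm g))⁻¹ : ℝ) * (g ⬝ᵥ x)) =
        (Function.eval (0 : Fin 1) : (Fin 1 → ℂ) → ℂ) ∘ fun x => M *ᵥ x := by
      ext x
      simp [M, Matrix.mulVec, dotProduct, Finset.mul_sum, mul_assoc]
    rw [h2, ← Measure.map_map (measurable_pi_apply 0) hmeas, map_mulVec_complexGaussianVec hM,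
      complexGaussianVec]
    exact (measurePreserving_eval _ 0).map_eq
  have h3 : ∀ i, IsProbabilityMeasure ((complexGaussianVec N (v i)).map
      (fun x => ((Real.sqrt (sqNorm g))⁻¹ : ℝ) * (g ⬝ᵥ x))) := fun i => by
    rw [hlaw]; infer_instance
  rw [Measure.pi_map_pi (f := fun _ x => ((Real.sqrt (sqNorm g))⁻¹ : ℝ) * (g ⬝ᵥ x))]
  · simp_rw [hlaw]
  · intro i
    simp only [dotProduct]
    exact Measurable.aemeasurable (by fun_prop)

/-- The law of `∑ |w_i|²` for independent complex Gaussian variables `w_i` of variances `v i`. -/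
def hypoexponential {ι : Type*} [Fintype ι] (v : ι → ℝ≥0) : Measure ℝ :=
  (Measure.pi fun i => complexGaussian (v i)).map fun w => ∑ i, ‖w i‖ ^ 2

instance {ι : Type*} [Fintype ι] (v : ι → ℝ≥0) : IsProbabilityMeasure (hypoexponential v) :=
  Measure.isProbabilityMeasure_map (Measurable.aemeasurable (by fun_prop))

/-- The right side is free of g, which is what makes the error power independent of the channel
estimate. -/
theorem map_sum_norm_dotProduct {ι : Type*} [Fintype ι] {N : ℕ} (v : ι → ℝ≥0)
    {g : Fin N → ℂ} (hg : 0 < sqNorm g) :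
    (Measure.pi fun i => complexGaussianVec N (v i)).map
        (fun e => (∑ i, ‖g ⬝ᵥ e i‖ ^ 2) / sqNorm g) = hypoexponential v := by
  rw [hypoexponential, ← map_normalized_dotProduct v hg, Measure.map_map (by fun_prop)
    (by simp only [dotProduct]; fun_prop)]
  congr 1
  ext e
  simp only [Function.comp_apply, norm_mul, mul_pow, Complex.norm_real, Real.norm_eq_abs, sq_abs,
    inv_pow, Real.sq_sqrt hg.le, ← Finset.mul_sum]
  rw [div_eq_inv_mul]

/-- The inverse noise amplification of the zero-forcing receiver and its normalized error power are
independent, with Erlang and hypoexponential laws. -/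
theorem measurePreserving_signal_error {ι : Type*} [Fintype ι] {N K n : ℕ}
    (hN : K + (n + 1) = N) (v : Fin (K + 1) → ℝ≥0) (hv : ∀ j, v j ≠ 0) (k : Fin (K + 1))
    (u : ι → ℝ≥0) :
    MeasurePreserving (fun p : (Fin (K + 1) → Fin N → ℂ) × (ι → Fin N → ℂ) =>
        ((sqNorm (pinv (ofCols p.1) k))⁻¹,
          (∑ i, ‖pinv (ofCols p.1) k ⬝ᵥ p.2 i‖ ^ 2) / sqNorm (pinv (ofCols p.1) k)))
      ((Measure.pi fun j => complexGaussianVec N (v j)).prod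
        (Measure.pi fun i => complexGaussianVec N (u i)))
      ((gammaMeasure (n + 1) (v k : ℝ)⁻¹).prod (hypoexponential u)) := by
  have h1 : ∀ a, Measurable fun p : (Fin (K + 1) → Fin N → ℂ) × (ι → Fin N → ℂ) =>
      pinv (ofCols p.1) k a := fun a => (measurable_pinv k a).comp measurable_fst
  have hg : Measurable (Function.uncurry fun (c : Fin (K + 1) → Fin N → ℂ) (e : ι → Fin N → ℂ) =>
      (∑ i, ‖pinv (ofCols c) k ⬝ᵥ e i‖ ^ 2) / sqNorm (pinv (ofCols c) k)) := by
    unfold Function.uncurry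
    refine Measurable.div (Finset.measurable_sum _ fun i _ => Measurable.pow_const
      (Measurable.norm (Finset.measurable_sum _ fun a _ => (h1 a).mul (by fun_prop))) 2)
      (Finset.measurable_sum _ fun a _ => (h1 a).norm.pow_const 2)
  refine (measurePreserving_inv_sqNorm_pinv hN v hv k).skew_product hg ?_
  filter_upwards [ae_linearIndependent (N := N) (by omega) v hv] with c hc
  exact map_sum_norm_dotProduct u (sqNorm_pinv_pos hc k)

/-! ### Moments of the hypoexponential distribution -/

section Moments

variable {ι : Type*} [Fintype ι]

theorem integral_exp_mul_hypoexponential {v : ι → ℝ≥0} (hv : ∀ i, v i ≠ 0) {t : ℝ}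
    (ht : ∀ i, t * v i < 1) :
    ∫ y, Real.exp (t * y) ∂hypoexponential v = ∏ i, (1 - t * v i)⁻¹ := by
  have h := integral_cexp_mul_sum_normSq hv (w := t) (by simpa using ht)
  rw [hypoexponential, integral_map (Measurable.aemeasurable (by fun_prop)) (by fun_prop)]
  rw [← Complex.ofReal_inj, ← integral_complex_ofReal]
  push_cast at h ⊢
  exact h

/-- A non-integrable function has integral 0 by convention, whereas the value already computed is a
product of positive factors. -/
theorem integrable_exp_mul_hypoexponential {v : ι → ℝ≥0} (hv : ∀ i, v i ≠ 0) {t : ℝ}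
    (ht : ∀ i, t * v i < 1) : Integrable (fun y => Real.exp (t * y)) (hypoexponential v) := by
  by_contra h
  have h1 := integral_exp_mul_hypoexponential hv ht
  rw [integral_undef h] at h1
  exact (Finset.prod_pos fun i _ => inv_pos.2 (sub_pos.2 (ht i))).ne h1

theorem mem_interior_integrableExpSet_hypoexponential {v : ι → ℝ≥0} (hv : ∀ i, v i ≠ 0) {t : ℝ}
    (ht : ∀ i, t * v i < 1) : t ∈ interior (integrableExpSet id (hypoexponential v)) := by
  have hopen : IsOpen {t : ℝ | ∀ i, t * v i < 1} := by
    simp only [Set.ofPred_forall]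
    exact isOpen_iInter_of_finite fun i => isOpen_lt (by fun_prop) continuous_const
  exact interior_maximal (fun s hs => integrable_exp_mul_hypoexponential hv hs) hopen ht

theorem integrable_pow_mul_exp_hypoexponential {v : ι → ℝ≥0} (hv : ∀ i, v i ≠ 0) {t : ℝ}
    (ht : ∀ i, t * v i < 1) (s : ℕ) :
    Integrable (fun y => y ^ s * Real.exp (t * y)) (hypoexponential v) :=
  integrable_pow_mul_exp_of_mem_interior_integrableExpSet
    (mem_interior_integrableExpSet_hypoexponential hv ht) s

/-- Each derivative brings out a factor s + q, absorbed by Γ(s + q + 1) = (s + q) Γ(s + q). The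
condition q ≥ 1 excludes the pole of Γ at 0. -/
theorem hasDerivAt_gamma_div_pow {μ t : ℝ} (h : 1 / μ - t ≠ 0) {q : ℕ} (hq : 1 ≤ q) (s : ℕ) :
    HasDerivAt (fun t : ℝ => Real.Gamma (s + q) / (1 / μ - t) ^ (s + q))
      (Real.Gamma ((s + 1 : ℕ) + q) / (1 / μ - t) ^ (s + 1 + q)) t := by
  have hsq : (s : ℝ) + q ≠ 0 := by positivity
  have hG : Real.Gamma ((s + 1 : ℕ) + q) = (s + q) * Real.Gamma (s + q) := by
    rw [← Real.Gamma_add_one hsq]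
    push_cast
    ring_nf
  have h1 : HasDerivAt (fun t : ℝ => (1 / μ - t) ^ (s + q))
      (((s + q : ℕ) : ℝ) * (1 / μ - t) ^ (s + q - 1) * (-1)) t :=
    ((hasDerivAt_id t).const_sub (1 / μ)).pow (s + q)
  refine ((h1.inv (pow_ne_zero _ h)).const_mul (Real.Gamma (s + q))).congr_deriv ?_
  obtain ⟨m, hm⟩ : ∃ m, s + q = m + 1 := ⟨s + q - 1, by omega⟩
  have hm' : (s : ℝ) + q = m + 1 := by exact_mod_cast hm
  rw [hG, show s + 1 + q = m + 2 by omega, hm, hm']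
  push_cast
  field_simp
  ring

/-- Exponentially weighted moments of the hypoexponential distribution in terms of the
characteristic coefficients. -/
theorem integral_pow_mul_exp_hypoexponential [Nonempty ι] {d : ι → ℝ} (hd : ∀ i, 0 < d i) (s : ℕ)
    {t : ℝ} (ht : ∀ i, t * d i < 1) :
    ∫ y, y ^ s * Real.exp (t * y) ∂hypoexponential (fun i => (d i).toNNReal) =
      ∑ μ ∈ distinctDiag d, ∑ q ∈ Finset.Icc 1 (diagMult d μ),
        charCoeff d μ q * (1 / (μ ^ q * ((q - 1).factorial : ℝ))) *
          (Real.Gamma (s + q) / (1 / μ - t) ^ (s + q)) := by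
  classical
  have hv : ∀ i, (d i).toNNReal ≠ 0 := fun i => by simpa using hd i
  have hcoe : ∀ i, ((d i).toNNReal : ℝ) = d i := fun i => Real.coe_toNNReal _ (hd i).le
  have hμ : ∀ μ ∈ distinctDiag d, ∃ i, d i = μ := fun μ h => by simpa [distinctDiag] using h
  have hopen : IsOpen {t : ℝ | ∀ i, t * d i < 1} := by
    simp only [Set.ofPred_forall]
    exact isOpen_iInter_of_finite fun i => isOpen_lt (by fun_prop) continuous_const
  have hpos : ∀ μ ∈ distinctDiag d, 0 < μ := fun μ h => by
    obtain ⟨i, rfl⟩ := hμ μ h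
    exact hd i
  have hsub : ∀ μ ∈ distinctDiag d, ∀ t : ℝ, (∀ i, t * d i < 1) → 0 < 1 / μ - t := by
    intro μ h t ht
    obtain ⟨i, rfl⟩ := hμ μ h
    rw [sub_pos, lt_div_iff₀ (hd i)]
    exact ht i
  induction s generalizing t with
  | zero =>
    simp only [pow_zero, one_mul]
    rw [integral_exp_mul_hypoexponential hv (by simpa only [hcoe] using ht)]
    -- At ξ = -t the determinant is the inverse of the moment generating function; then 1 - tμ = μ
    -- (1/μ - t) and Γ(q) = (q - 1)! recast the partial fractions.
    have h := charCoeff_spec d (fun i => (hd i).ne') (-t)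
      (fun i => by have := ht i; linarith)
    have hdet : Matrix.det (1 + (-t) • Matrix.diagonal d) = ∏ i, (1 - t * d i) := by
      have : (1 + (-t) • Matrix.diagonal d) = Matrix.diagonal fun i => 1 - t * d i := by
        rw [← Matrix.diagonal_one, ← Matrix.diagonal_smul, Matrix.diagonal_add]
        congr 1
        ext i
        simp
        ring
      rw [this, Matrix.det_diagonal]
    rw [hdet] at h
    simp_rw [hcoe]
    rw [Finset.prod_inv_distrib, h]
    refine Finset.sum_congr rfl fun μ hm => Finset.sum_congr rfl fun q hq => ?_
    have hq1 := (Finset.mem_Icc.1 hq).1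
    obtain ⟨m, rfl⟩ : ∃ m, q = m + 1 := ⟨q - 1, by omega⟩
    have hG : Real.Gamma (((0 : ℕ) : ℝ) + ((m + 1 : ℕ) : ℝ)) = m.factorial := by
      push_cast
      rw [zero_add, Real.Gamma_nat_eq_factorial]
    have h1 := hsub μ hm t ht
    have h2 := hpos μ hm
    have h3 : (m.factorial : ℝ) ≠ 0 := by positivity
    have h4 : 1 + -t * μ = μ * (1 / μ - t) := by
      field_simp
      ring
    rw [hG, h4, mul_pow, Nat.add_sub_cancel, zero_add]
    have h5 : (1 / μ - t) ^ (m + 1) ≠ 0 := by positivity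
    generalize (1 / μ - t) ^ (m + 1) = x at *
    field_simp
  | succ s ih =>
    -- Differentiating under the integral brings down a factor y. The induction hypothesis holds on
    -- an open set of parameters, so the two derivatives agree.
    have h1 := hasDerivAt_integral_pow_mul_exp_real
      (mem_interior_integrableExpSet_hypoexponential hv (t := t)
        (by simpa only [hcoe] using ht)) s
    have h2 : HasDerivAt (fun t => ∑ μ ∈ distinctDiag d, ∑ q ∈ Finset.Icc 1 (diagMult d μ),
        charCoeff d μ q * (1 / (μ ^ q * ((q - 1).factorial : ℝ))) *
          (Real.Gamma (s + q) / (1 / μ - t) ^ (s + q)))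
        (∑ μ ∈ distinctDiag d, ∑ q ∈ Finset.Icc 1 (diagMult d μ),
        charCoeff d μ q * (1 / (μ ^ q * ((q - 1).factorial : ℝ))) *
          (Real.Gamma ((s + 1 : ℕ) + q) / (1 / μ - t) ^ (s + 1 + q))) t :=
      HasDerivAt.fun_sum fun μ hm => HasDerivAt.fun_sum fun q hq =>
        (hasDerivAt_gamma_div_pow (hsub μ hm t ht).ne' (Finset.mem_Icc.1 hq).1 s).const_mul _
    refine h1.unique (h2.congr_of_eventuallyEq ?_)
    filter_upwards [hopen.mem_nhds ht] with u hu
    exact ih hu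

end Moments

/-! ### The outage probability -/

section Outage

variable {ι : Type*} [Fintype ι]

theorem ae_nonneg_hypoexponential (v : ι → ℝ≥0) : ∀ᵐ y ∂hypoexponential v, 0 ≤ y := by
  rw [hypoexponential, ae_map_iff (Measurable.aemeasurable (by fun_prop)) measurableSet_Ici]
  exact ae_of_all _ fun w => Finset.sum_nonneg fun i _ => by positivity

/-- The binomial expansion isolates the dependence on y in the factors y^s e^(-ay), whose
expectations are known. -/
theorem exp_mul_sum_pow_add (n : ℕ) (a b y : ℝ) :
    Real.exp (-(a * (y + b))) * ∑ t ∈ Finset.range (n + 1), (a * (y + b)) ^ t / t.factorial =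
      Real.exp (-(a * b)) * ∑ t ∈ Finset.range (n + 1), ∑ s ∈ Finset.range (t + 1),
        ((t.choose s : ℝ) * (a ^ t / t.factorial) * b ^ (t - s)) *
          (y ^ s * Real.exp (-a * y)) := by
  rw [show -(a * (y + b)) = -(a * b) + -a * y by ring, Real.exp_add, mul_assoc, Finset.mul_sum]
  congr 1
  refine Finset.sum_congr rfl fun t _ => ?_
  rw [mul_pow, add_pow, Finset.mul_sum, Finset.sum_div, Finset.mul_sum]
  exact Finset.sum_congr rfl fun s _ => by ring

/-- The probability that an Erlang variable of rate `r` does not exceed `a (Y + b) / r`, for an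
independent hypoexponential `Y`. -/
theorem gammaMeasure_prod_hypoexponential [Nonempty ι] {d : ι → ℝ} (hd : ∀ i, 0 < d i) (n : ℕ)
    {r a b : ℝ} (hr : 0 < r) (ha : 0 ≤ a) (hb : 0 ≤ b) :
    ((gammaMeasure (n + 1) r).prod (hypoexponential fun i => (d i).toNNReal)).real
        {p | r * p.1 ≤ a * (p.2 + b)} =
      1 - Real.exp (-(a * b)) *
        ∑ μ ∈ distinctDiag d, ∑ q ∈ Finset.Icc 1 (diagMult d μ),
          ∑ t ∈ Finset.range (n + 1), ∑ s ∈ Finset.range (t + 1),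
            (t.choose s : ℝ) * charCoeff d μ q * (1 / (μ ^ q * ((q - 1).factorial : ℝ))) *
              (a ^ t / t.factorial) * b ^ (t - s) *
              (Real.Gamma (s + q) / (1 / μ + a) ^ (s + q)) := by
  have hprob := isProbabilityMeasure_gammaMeasure (a := (n : ℝ) + 1) (by positivity) hr
  set ν := hypoexponential fun i => (d i).toNNReal with hν
  have hv : ∀ i, (d i).toNNReal ≠ 0 := fun i => by simpa using hd i
  have hcoe : ∀ i, ((d i).toNNReal : ℝ) = d i := fun i => Real.coe_toNNReal _ (hd i).le
  have ht : ∀ i, -a * d i < 1 := fun i => by nlinarith [hd i, mul_nonneg ha (hd i).le]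
  have hS : MeasurableSet {p : ℝ × ℝ | r * p.1 ≤ a * (p.2 + b)} :=
    measurableSet_le (by fun_prop) (by fun_prop)
  have hint : ∀ s : ℕ, Integrable (fun y => y ^ s * Real.exp (-a * y)) ν := fun s =>
    integrable_pow_mul_exp_hypoexponential hv (by simpa only [hcoe] using ht) s
  rw [measureReal_def, Measure.prod_apply_symm hS, ← integral_toReal
    (measurable_measure_prodMk_right hS).aemeasurable (ae_of_all _ fun _ => measure_lt_top _ _)]
  -- For fixed y ≥ 0 the slice is a half-line with nonnegative endpoint, so the Erlang distribution
  -- function applies.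
  have h1 : ∀ᵐ y ∂ν, (gammaMeasure (n + 1) r
      ((fun x => (x, y)) ⁻¹' {p : ℝ × ℝ | r * p.1 ≤ a * (p.2 + b)})).toReal =
      1 - Real.exp (-(a * b)) * ∑ t ∈ Finset.range (n + 1), ∑ s ∈ Finset.range (t + 1),
        ((t.choose s : ℝ) * (a ^ t / t.factorial) * b ^ (t - s)) *
          (y ^ s * Real.exp (-a * y)) := by
    filter_upwards [ae_nonneg_hypoexponential _] with y hy
    have h2 : (fun x => (x, y)) ⁻¹' {p : ℝ × ℝ | r * p.1 ≤ a * (p.2 + b)} =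
        Set.Iic (a * (y + b) / r) := by
      ext x
      simp only [Set.mem_preimage, Set.mem_ofPred_eq, Set.mem_Iic, le_div_iff₀ hr, mul_comm r]
    rw [h2, ← measureReal_def, gammaMeasure_Iic n hr (by positivity), mul_div_cancel₀ _ hr.ne',
      exp_mul_sum_pow_add]
  have hint2 : ∀ t, Integrable (fun y => ∑ s ∈ Finset.range (t + 1),
      ((t.choose s : ℝ) * (a ^ t / t.factorial) * b ^ (t - s)) *
        (y ^ s * Real.exp (-a * y))) ν := fun t =>
    integrable_finsetSum _ fun s _ => (hint s).const_mul _
  rw [integral_congr_ae h1, integral_sub (integrable_const _)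
    ((integrable_finsetSum _ fun t _ => hint2 t).const_mul _), integral_const_mul,
    integral_finsetSum _ fun t _ => hint2 t]
  simp_rw [integral_finsetSum (μ := ν) _ fun s _ => (hint s).const_mul _, integral_const_mul]
  rw [integral_const, probReal_univ, one_smul]
  congr 2
  simp_rw [hν, integral_pow_mul_exp_hypoexponential hd _ ht, sub_neg_eq_add, Finset.mul_sum]
  simp_rw [Finset.sum_comm (s := Finset.range _) (t := distinctDiag d)]
  refine Finset.sum_congr rfl fun μ _ => ?_
  simp_rw [Finset.sum_comm (s := Finset.range _) (t := Finset.Icc _ _)]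
  refine Finset.sum_congr rfl fun q _ => Finset.sum_congr rfl fun t _ =>
    Finset.sum_congr rfl fun s _ => ?_
  ring

end Outage

/-! ### Positivity of the network parameters -/

section Parameters

variable {L K τ : ℕ} {β : Fin L → Fin L → Fin K → ℝ} {pr : ℝ}

theorem betaHat_pos (hβ : ∀ l i k, 0 < β l i k) (hpr : 0 < pr) (hτ : 0 < τ) (l i : Fin L)
    (k : Fin K) : 0 < betaHat β pr τ l i k := by
  have h1 : 0 ≤ ∑ j, β l j k := Finset.sum_nonneg fun j _ => (hβ l j k).le
  have := hβ l i k
  unfold betaHat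
  positivity

/-- The denominator of β̂ strictly exceeds β because of the training noise, so β̂ < β, and α² ≤ 1.
-/
theorem errVar_pos (hβ : ∀ l i k, 0 < β l i k) (hpr : 0 < pr) (hτ : 0 < τ) {α : ℝ}
    (hα : |α| ≤ 1) (l i : Fin L) (k : Fin K) : 0 < errVar β pr τ α l i k := by
  have h1 : β l i k ≤ ∑ j, β l j k :=
    Finset.single_le_sum (f := fun j => β l j k) (fun j _ => (hβ l j k).le) (Finset.mem_univ i)
  have h2 := hβ l i k
  have h3 : 0 < 1 / ((τ : ℝ) * pr) := by positivity
  have h4 : betaHat β pr τ l i k < β l i k := by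
    rw [betaHat, div_lt_iff₀ (by linarith)]
    nlinarith
  have h5 : α ^ 2 ≤ 1 := by rwa [sq_le_one_iff_abs_le_one]
  have h6 := betaHat_pos hβ hpr hτ l i k
  unfold errVar
  nlinarith

theorem contamination_nonneg (l : Fin L) (k : Fin K) : 0 ≤ contamination β l k :=
  Finset.sum_nonneg fun _ _ => sq_nonneg _

end Parameters

/-! ### The outage event for a channel estimate of full column rank -/

section Receiver

variable {L N K : ℕ} {β : Fin L → Fin L → Fin K → ℝ} {pr α : ℝ}

theorem sinr_eq {c : Fin K → Fin N → ℂ} (hc : LinearIndependent ℂ c) (l : Fin L) (k : Fin K)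
    (e : Fin L × Fin K → Fin N → ℂ) :
    sinr β pr α l k (ofCols c) (fun i => ofCols fun j => e (i, j)) =
      α ^ 2 * pr / (α ^ 2 * pr * contamination β l k +
        pr * ∑ ij, ‖pinv (ofCols c) k ⬝ᵥ e ij‖ ^ 2 + sqNorm (pinv (ofCols c) k)) := by
  rw [sinr, contamination, Fintype.sum_prod_type]
  simp_rw [vecMul_crossEstimate hc]
  rfl

/-- No sign is imposed on 1 - γC, so this form serves both cases of the theorem. -/
theorem sinr_le_iff {c : Fin K → Fin N → ℂ} (hc : LinearIndependent ℂ c) (hpr : 0 < pr)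
    (l : Fin L) (k : Fin K) (e : Fin L × Fin K → Fin N → ℂ) (γ : ℝ) :
    sinr β pr α l k (ofCols c) (fun i => ofCols fun j => e (i, j)) ≤ γ ↔
      α ^ 2 * (1 - γ * contamination β l k) * (sqNorm (pinv (ofCols c) k))⁻¹ ≤
        γ * ((∑ ij, ‖pinv (ofCols c) k ⬝ᵥ e ij‖ ^ 2) / sqNorm (pinv (ofCols c) k) + 1 / pr) := by
  rw [sinr_eq hc]
  have hX := sqNorm_pinv_pos hc k
  have hQ : 0 ≤ ∑ ij, ‖pinv (ofCols c) k ⬝ᵥ e ij‖ ^ 2 :=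
    Finset.sum_nonneg fun _ _ => by positivity
  have hC := contamination_nonneg (β := β) l k
  generalize sqNorm (pinv (ofCols c) k) = X at *
  generalize ∑ ij, ‖pinv (ofCols c) k ⬝ᵥ e ij‖ ^ 2 = Q at *
  generalize contamination β l k = C at *
  have h1 : γ * (Q / X + 1 / pr) - α ^ 2 * (1 - γ * C) * X⁻¹ =
      (γ * (α ^ 2 * pr * C + pr * Q + X) - α ^ 2 * pr) / (pr * X) := by
    field_simp
    ring
  rw [div_le_iff₀ (by positivity), ← sub_nonneg, ← sub_nonneg (b := α ^ 2 * (1 - γ * C) * X⁻¹), h1]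
  rw [le_div_iff₀ (by positivity), zero_mul]

end Receiver

/-- Transfers the problem from the abstract probability space to a product of Gaussian measures,
where one can condition on the channel block. -/
theorem map_columns_eq_prod {Ω ι κ E : Type*} [MeasurableSpace Ω] [MeasurableSpace E] [Fintype ι]
    [Fintype κ] {P : Measure Ω} [IsProbabilityMeasure P] {X : ι → Ω → E} {Y : κ → Ω → E}
    {μ : ι → Measure E} {ν : κ → Measure E} [∀ i, SigmaFinite (μ i)] [∀ i, SigmaFinite (ν i)]
    (hX : ∀ i, HasLaw (X i) (μ i) P) (hY : ∀ i, HasLaw (Y i) (ν i) P)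
    (hindep : iIndepFun (Sum.elim X Y) P) :
    P.map (fun ω => ((fun i => X i ω), fun j => Y j ω)) =
      (Measure.pi μ).prod (Measure.pi ν) := by
  have hm : ∀ i, AEMeasurable (Sum.elim X Y i) P := by
    rintro (i | i)
    exacts [(hX i).aemeasurable, (hY i).aemeasurable]
  have h1 := (iIndepFun_iff_map_fun_eq_pi_map hm).1 hindep
  have h2 : (fun i => P.map (Sum.elim X Y i)) = Sum.elim μ ν := by
    ext1 (i | i)
    exacts [(hX i).map_eq, (hY i).map_eq]
  rw [h2] at h1
  have : ∀ i, SigmaFinite (Sum.elim μ ν i) := by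
    rintro (i | i) <;> simp only [Sum.elim_inl, Sum.elim_inr] <;> infer_instance
  have mp := measurePreserving_sumPiEquivProdPi (X := fun _ : ι ⊕ κ => E) (Sum.elim μ ν)
  have h3 := mp.map_eq
  rw [← h1, AEMeasurable.map_map_of_aemeasurable mp.measurable.aemeasurable
    (aemeasurable_pi_lambda _ hm)] at h3
  exact h3

end Uplink

end

/-! ### Assembly of the outage formula -/

theorem theorem2
    {Ω : Type*} [MeasurableSpace Ω] (P : Measure Ω) [IsProbabilityMeasure P]
    (L N K τ : ℕ) (hKN : K ≤ N) (hKτ : K ≤ τ)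
    (β : Fin L → Fin L → Fin K → ℝ) (hβ : ∀ l i k, 0 < β l i k)
    (pr : ℝ) (hpr : 0 < pr)
    (α : ℝ) (hα0 : α ≠ 0) (hα1 : |α| ≤ 1)
    (l : Fin L) (k : Fin K)
    -- the columns of the estimated channel matrix and of the error matrices
    (ghat : Fin K → Ω → Fin N → ℂ) (etilde : Fin L × Fin K → Ω → Fin N → ℂ)
    (hghat : ∀ j, HasLaw (ghat j)
      (Uplink.complexGaussianVec N (Uplink.betaHat β pr τ l l j).toNNReal) P)
    (hetilde : ∀ ij : Fin L × Fin K, HasLaw (etilde ij)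
      (Uplink.complexGaussianVec N (Uplink.errVar β pr τ α l ij.1 ij.2).toNNReal) P)
    (hindep : iIndepFun (Sum.elim ghat etilde) P)
    (γth : ℝ) (hγth : 0 ≤ γth) :
    -- the case `γth ≥ 1 / C`, where `1 / C = ∞` for `C = 0`
    (1 ≤ γth * Uplink.contamination β l k →
      Uplink.outageProb P β pr α l k ghat etilde γth = 1) ∧
    -- the case `γth < 1 / C`
    (γth * Uplink.contamination β l k < 1 →
      Uplink.outageProb P β pr α l k ghat etilde γth =
        1 - Real.exp (-(γth / (pr * Uplink.gammaBar β pr τ α l k γth))) *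
          ∑ μ ∈ Uplink.distinctDiag (Uplink.diagA β pr τ α l),
          ∑ q ∈ Finset.Icc 1 (Uplink.diagMult (Uplink.diagA β pr τ α l) μ),
          ∑ t ∈ Finset.range (N - K + 1),
          ∑ s ∈ Finset.range (t + 1),
            (t.choose s : ℝ) * Uplink.charCoeff (Uplink.diagA β pr τ α l) μ q *
              (1 / (μ ^ q * ((q - 1).factorial : ℝ))) *
              ((γth / Uplink.gammaBar β pr τ α l k γth) ^ t / (t.factorial : ℝ)) *
              (1 / pr) ^ (t - s) *
              (Real.Gamma ((s : ℝ) + (q : ℝ)) /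
                (1 / μ + γth / Uplink.gammaBar β pr τ α l k γth) ^ (s + q))) := by
  obtain _ | K := K
  · exact k.elim0
  -- The number of users is now K + 1, so n is the original N - K and the Erlang shape is n + 1.
  obtain ⟨n, rfl⟩ : ∃ n, N = K + (n + 1) := ⟨N - K - 1, by omega⟩
  have hτ : 0 < τ := by omega
  have hbeta : ∀ j, 0 < Uplink.betaHat β pr τ l l j := fun j =>
    Uplink.betaHat_pos hβ hpr hτ l l j
  have herr : ∀ ij, 0 < Uplink.diagA β pr τ α l ij := fun ij =>
    Uplink.errVar_pos hβ hpr hτ hα1 l ij.1 ij.2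
  have hcols := Uplink.map_columns_eq_prod hghat hetilde hindep
  have hm : AEMeasurable (fun ω => ((fun i => ghat i ω), fun ij => etilde ij ω)) P :=
    (aemeasurable_pi_lambda _ fun i => (hghat i).aemeasurable).prodMk
      (aemeasurable_pi_lambda _ fun ij => (hetilde ij).aemeasurable)
  have hli : ∀ᵐ ω ∂P, LinearIndependent ℂ fun j => ghat j ω := by
    have h1 := Uplink.ae_linearIndependent (N := K + (n + 1)) hKN
      (fun j => (Uplink.betaHat β pr τ l l j).toNNReal) (fun j => by simpa using hbeta j)
    have h2 := (Measure.quasiMeasurePreserving_fst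
      (ν := Measure.pi fun ij : Fin L × Fin (K + 1) => Uplink.complexGaussianVec (K + (n + 1))
        (Uplink.errVar β pr τ α l ij.1 ij.2).toNNReal)).ae h1
    rw [← hcols] at h2
    exact ae_of_ae_map hm h2
  refine ⟨fun hC => ?_, fun hC => ?_⟩
  · have h : ∀ᵐ ω ∂P, Uplink.sinr β pr α l k (Uplink.ofCols fun j => ghat j ω)
        (fun i => Uplink.ofCols fun j => etilde (i, j) ω) ≤ γth := by
      filter_upwards [hli] with ω hω
      rw [Uplink.sinr_le_iff hω hpr l k (fun ij => etilde ij ω)]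
      have hX := Uplink.sqNorm_pinv_pos hω k
      refine le_trans (mul_nonpos_of_nonpos_of_nonneg
        (mul_nonpos_of_nonneg_of_nonpos (sq_nonneg α) (by linarith)) (by positivity)) ?_
      positivity
    rw [Uplink.outageProb, measureReal_def, measure_congr (Filter.eventuallyEq_univ.2 h), measure_univ,
      ENNReal.toReal_one]
  · have hγC : 0 < 1 - γth * Uplink.contamination β l k := by linarith
    have hα2 : 0 < α ^ 2 := by positivity
    have hgbar : Uplink.gammaBar β pr τ α l k γth = Uplink.betaHat β pr τ l l k *
        (α ^ 2 * (1 - γth * Uplink.contamination β l k)) := by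
      rw [Uplink.gammaBar]; ring
    have hb := hbeta k
    have hgbar0 : 0 < Uplink.gammaBar β pr τ α l k γth := by
      rw [hgbar]; positivity
    have : Nonempty (Fin L × Fin (K + 1)) := ⟨(l, k)⟩
    have mp := Uplink.measurePreserving_signal_error (N := K + (n + 1)) rfl
      (fun j => (Uplink.betaHat β pr τ l l j).toNNReal) (fun j => by simpa using hbeta j) k
      (fun ij : Fin L × Fin (K + 1) => (Uplink.diagA β pr τ α l ij).toNNReal)
    have hcols' : P.map (fun ω => ((fun i => ghat i ω), fun ij => etilde ij ω)) =
      (Measure.pi fun j => Uplink.complexGaussianVec (K + (n + 1))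
          (Uplink.betaHat β pr τ l l j).toNNReal).prod
        (Measure.pi fun ij => Uplink.complexGaussianVec (K + (n + 1))
          (Uplink.diagA β pr τ α l ij).toNNReal) := hcols
    have hlaw := mp.map_eq
    rw [← hcols', AEMeasurable.map_map_of_aemeasurable mp.measurable.aemeasurable hm,
      Real.coe_toNNReal _ hb.le] at hlaw
    -- The Erlang rate is r = 1/β̂_llk; dividing the outage inequality by γ̄ = β̂_llk α²(1 - γC)
    -- gives r Z ≤ a (Y + b) with a = γ/γ̄ and b = 1/p_r.
    have key := Uplink.gammaMeasure_prod_hypoexponential herr n (inv_pos.2 hb)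
      (a := γth / Uplink.gammaBar β pr τ α l k γth) (b := 1 / pr) (by positivity) (by positivity)
    rw [← hlaw, measureReal_def, Measure.map_apply_of_aemeasurable
      (mp.measurable.comp_aemeasurable hm) (measurableSet_le (by fun_prop) (by fun_prop))] at key
    have hab : γth / Uplink.gammaBar β pr τ α l k γth * (1 / pr) =
        γth / (pr * Uplink.gammaBar β pr τ α l k γth) := by
      field_simp
    rw [hab] at key
    rw [show K + (n + 1) - (K + 1) = n by omega, ← key, Uplink.outageProb, measureReal_def]
    congr 1
    refine measure_congr ?_
    filter_upwards [hli] with ω hω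
    refine propext ?_
    refine (Uplink.sinr_le_iff hω hpr l k (fun ij => etilde ij ω) γth).trans ?_
    change _ ↔ (Uplink.betaHat β pr τ l l k)⁻¹ *
      (Uplink.sqNorm (Uplink.pinv (Uplink.ofCols fun j => ghat j ω) k))⁻¹ ≤
      γth / Uplink.gammaBar β pr τ α l k γth *
        ((∑ ij, ‖Uplink.pinv (Uplink.ofCols fun j => ghat j ω) k ⬝ᵥ etilde ij ω‖ ^ 2) /
          Uplink.sqNorm (Uplink.pinv (Uplink.ofCols fun j => ghat j ω) k) + 1 / pr)
    rw [hgbar]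
    generalize (Uplink.sqNorm _)⁻¹ = Z
    generalize _ / Uplink.sqNorm _ + 1 / pr = Y
    generalize Uplink.betaHat β pr τ l l k = b at *
    rw [show b⁻¹ * Z = α ^ 2 * (1 - γth * Uplink.contamination β l k) * Z /
        (b * (α ^ 2 * (1 - γth * Uplink.contamination β l k))) by field_simp,
      div_mul_eq_mul_div, div_le_div_iff_of_pos_right (by positivity)]
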